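/- Let $X$ be a Banach space of real sequences indexed by $\mathbb{Z}$ with monotone norm: if $b\in X$ and $|a_n|\le|b_n|$ for all $n\in\mathbb{Z}$, then $a\in X$ and $\|a\|_X\le\|b\|_X$; put $\|a\|_X=\infty$ for sequences $a\notin X$. Let $\mathcal{A}:[0,\infty)\to[0,\infty)$ be a Young function, that is, continuous, convex and nondecreasing with $\mathcal{A}(0)=0$ and $\lim_{t\to\infty}\mathcal{A}(t)=\infty$, and let $\overline{\mathcal{A}}(t)=\sup_{s\ge0}(st-\mathcal{A}(s))\in[0,\infty]$ be its complementary function. For a ball $B\subset\mathbb{R}^n$ put $$\|f\|_{\mathcal{A},B}=\inf\Big\{\lambda>0:\frac1{|B|}\int_B\mathcal{A}\big(|f|/\lambda\big)\le1\Big\},$$ (similarly for $\overline{\mathcal A}$; for vector-valued $f$, $|f|$ is replaced by $\|f\|_X$), $\|f\|_{\mathcal{A},|y|\sim s}=\|f\chi_{\{s<|y|\le2s\}}\|_{\mathcal{A},B(0,2s)}$, and $M_{\overline{\mathcal{A}}}f(x)=\sup_{B\ni x}\|f\|_{\overline{\mathcal{A}},B}$, the supremum being over all balls containing $x$. Let $K=\{K_l\}_{l\in\mathbb{Z}}:\mathbb{R}^n\setminus\{0\}\to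 X$ be strongly measurable with $K_l\in L^1_{\rm loc}(\mathbb{R}^n\setminus\{0\})$ for every $l$, and let $$Tf(x)=\Big\{\mathrm{p.v.}\int_{\mathbb{R}^n}K_l(x-y)f(y)\,dy\Big\}_{l\in\mathbb{Z}}$$ be a vector-valued singular integral operator, meaning that: (i) for every $f\in L^\infty_c(\mathbb{R}^n)$ (real-valued, bounded, with compact support) these principal values exist for almost every $x$; (ii) $T$ is of strong type $(p_0,p_0)$ for some $1<p_0<\infty$ in the sense of Bochner–Lebesgue spaces: there is a constant $C_0$ such that for all $f\in L^\infty_c(\mathbb{R}^n)$ the function $Tf$ is a strongly measurable $X$-valued function with $\|Tf\|_{L^{p_0}_X}\le C_0\|f\|_{L^{p_0}}$; (iii) $K\in H_{1,X}$: there are $c>1$ and $C_1>0$ such that for all $x\in\mathbb{R}^n$ and $R>c|x|$, with $\mathcal D(t)=t$, $$\sum_{m=1}^\infty(2^mR)^n\,\big\|\,\|K(\cdot-x)-K(\cdot)\|_X\big\|_{\mathcal{D},|y|\sim2^mR}\le C_1.$$ Suppose in addition that $K\in H^\dagger_{\mathcal{A},X}$: there are $c_{\mathcal{A}}>1$ and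 $C_{\mathcal{A}}>0$ such that for all $x\in\mathbb{R}^n$ and $R>c_{\mathcal{A}}|x|$, $$\bigg\|\Big\{\sum_{m=1}^\infty(2^mR)^n\,\|K_l(\cdot-x)-K_l(\cdot)\|_{\mathcal{A},|y|\sim2^mR}\Big\}_{l\in\mathbb{Z}}\bigg\|_X\le C_{\mathcal{A}}.$$ Then for every $0<p<\infty$ and every weight $w\in A_\infty=\bigcup_{1<q<\infty}A_q$ (Muckenhoupt classes) there is a constant $C$ such that $$\int_{\mathbb{R}^n}\|Tf(x)\|_X^p\,w(x)\,dx\le C\int_{\mathbb{R}^n}\big(M_{\overline{\mathcal{A}}}f(x)\big)^p\,w(x)\,dx$$ for every $f\in L^\infty_c(\mathbb{R}^n)$ for which the left-hand side is finite. -/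

import Mathlib

open MeasureTheory Filter Topology
open scoped NNReal ENNReal

/-- A Banach space `X` of real sequences indexed by `ℤ` with monotone norm: an element is determined
by its coordinates, and if `|a n| ≤ |b n|` for all `n` with `b` in `X`, then `a` is in `X` and its
norm is at most that of `b` (sequences outside `X` are thought of as having norm `∞`). -/
class BanachSequenceSpace (X : Type*) [NormedAddCommGroup X] [NormedSpace ℝ X] where
  coord : X →ₗ[ℝ] (ℤ → ℝ)
  coord_injective : Function.Injective coord
  monotone_norm : ∀ (b : X) (a : ℤ → ℝ), (∀ n, |a n| ≤ |coord b n|) →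
    ∃ v : X, coord v = a ∧ ‖v‖ ≤ ‖b‖

noncomputable section

/-- The norm of `X` on all real sequences, with value `∞` off `X`. -/
def seqNorm (X : Type*) [NormedAddCommGroup X] [NormedSpace ℝ X] [BanachSequenceSpace X]
    (a : ℤ → ℝ) : ℝ≥0∞ :=
  ⨅ (v : X) (_ : BanachSequenceSpace.coord v = a), ‖v‖ₑ

/-- Young functions `[0,∞) → [0,∞)`. -/
structure IsYoungFunction (A : ℝ≥0 → ℝ≥0) : Prop where
  continuous : Continuous A
  convex : ConvexOn ℝ≥0 Set.univ A
  monotone : Monotone A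
  map_zero : A 0 = 0
  tendsto_atTop : Tendsto A atTop atTop

/-- The complementary function `t ↦ sup_{s ≥ 0} (t s - A s)`, which may take the value `∞`.
The subtraction is truncated at `0`; this does not change the supremum when `A 0 = 0`. -/
def complementary (A : ℝ≥0 → ℝ≥0) (t : ℝ≥0) : ℝ≥0∞ :=
  ⨆ s : ℝ≥0, ((t * s : ℝ≥0) : ℝ≥0∞) - (A s : ℝ≥0∞)

/-- The Luxemburg average of `f` over the set `B` (infimum of the empty set is `∞`). -/
def luxNorm {n : ℕ} {G : Type*} [NormedAddCommGroup G] (Φ : ℝ≥0 → ℝ≥0∞)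
    (f : EuclideanSpace ℝ (Fin n) → G) (B : Set (EuclideanSpace ℝ (Fin n))) : ℝ≥0∞ :=
  ⨅ (lam : ℝ≥0) (_ : 0 < lam ∧ (volume B)⁻¹ * ∫⁻ x in B, Φ (‖f x‖₊ / lam) ≤ 1), (lam : ℝ≥0∞)

/-- The Luxemburg average over `B(0, 2s)` of `f` restricted to the annulus `s < |y| ≤ 2s`. -/
def luxAnnulus {n : ℕ} {G : Type*} [NormedAddCommGroup G] (Φ : ℝ≥0 → ℝ≥0∞)
    (f : EuclideanSpace ℝ (Fin n) → G) (s : ℝ) : ℝ≥0∞ :=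
  luxNorm Φ (Set.indicator {y | s < ‖y‖ ∧ ‖y‖ ≤ 2 * s} f) (Metric.ball 0 (2 * s))

/-- The maximal operator `M_Φ f (x) = sup_{B ∋ x} ‖f‖_{Φ,B}` over balls `B`. -/
def luxMaximal {n : ℕ} (Φ : ℝ≥0 → ℝ≥0∞) (f : EuclideanSpace ℝ (Fin n) → ℝ)
    (x : EuclideanSpace ℝ (Fin n)) : ℝ≥0∞ :=
  ⨆ (c : EuclideanSpace ℝ (Fin n)) (r : ℝ) (_ : 0 < r ∧ x ∈ Metric.ball c r),
    luxNorm Φ f (Metric.ball c r)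

/-- The Muckenhoupt class `A_q`, `1 < q < ∞`. In `ℝ≥0∞`, a negative power of `0` is `∞`. -/
def MuckenhouptA {n : ℕ} (q : ℝ) (w : EuclideanSpace ℝ (Fin n) → ℝ) : Prop :=
  (∀ x, 0 ≤ w x) ∧ LocallyIntegrable w ∧
  ∃ C : ℝ≥0, ∀ (c : EuclideanSpace ℝ (Fin n)) (r : ℝ), 0 < r →
    ((volume (Metric.ball c r))⁻¹ * ∫⁻ x in Metric.ball c r, ENNReal.ofReal (w x)) *
      ((volume (Metric.ball c r))⁻¹ *
        ∫⁻ x in Metric.ball c r, ENNReal.ofReal (w x) ^ (-(1 / (q - 1)))) ^ (q - 1) ≤ C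

/-- `A_∞` is the union of the classes `A_q`, `1 < q < ∞`. -/
def MuckenhouptAInfty {n : ℕ} (w : EuclideanSpace ℝ (Fin n) → ℝ) : Prop :=
  ∃ q : ℝ, 1 < q ∧ MuckenhouptA q w

/-- Bounded functions with compact support. -/
def MemLInftyC {n : ℕ} (f : EuclideanSpace ℝ (Fin n) → ℝ) : Prop :=
  MemLp f ∞ volume ∧ HasCompactSupport f

section Kernel

variable {n : ℕ} {X : Type*} [NormedAddCommGroup X] [NormedSpace ℝ X] [BanachSequenceSpace X]

/-- The `l`-th coordinate `K_l` of a vector-valued kernel. -/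
def kernelCoord (K : EuclideanSpace ℝ (Fin n) → X) (l : ℤ) (y : EuclideanSpace ℝ (Fin n)) : ℝ :=
  BanachSequenceSpace.coord (K y) l

/-- The truncated integral of `K_l (x - y) f y` over `|x - y| > ε`. -/
def truncInt (K : EuclideanSpace ℝ (Fin n) → X) (f : EuclideanSpace ℝ (Fin n) → ℝ) (l : ℤ)
    (x : EuclideanSpace ℝ (Fin n)) (ε : ℝ) : ℝ :=
  ∫ y in {y | ε < ‖x - y‖}, kernelCoord K l (x - y) * f y

/-- `Tf(x) = { p.v. ∫ K_l (x - y) f y dy }_l`. -/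
def singularIntegral (K : EuclideanSpace ℝ (Fin n) → X) (f : EuclideanSpace ℝ (Fin n) → ℝ)
    (x : EuclideanSpace ℝ (Fin n)) (l : ℤ) : ℝ :=
  limUnder (𝓝[>] (0 : ℝ)) (truncInt K f l x)

/-- The class `H_{Φ,X}`. The summation index is `m + 1`, `m ≥ 0`. -/
def HormanderClass (Φ : ℝ≥0 → ℝ≥0∞) (K : EuclideanSpace ℝ (Fin n) → X) : Prop :=
  ∃ c : ℝ, 1 < c ∧ ∃ C : ℝ≥0, ∀ (x : EuclideanSpace ℝ (Fin n)) (R : ℝ), c * ‖x‖ < R →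
    ∑' m : ℕ, ENNReal.ofReal ((2 ^ (m + 1) * R) ^ n) *
      luxAnnulus Φ (fun y => K (y - x) - K y) (2 ^ (m + 1) * R) ≤ C

/-- The `l`-th entry of the sequence whose norm is bounded in the class `H^†_{Φ,X}`. -/
def daggerEntry (Φ : ℝ≥0 → ℝ≥0∞) (K : EuclideanSpace ℝ (Fin n) → X)
    (x : EuclideanSpace ℝ (Fin n)) (R : ℝ) (l : ℤ) : ℝ≥0∞ :=
  ∑' m : ℕ, ENNReal.ofReal ((2 ^ (m + 1) * R) ^ n) *
    luxAnnulus Φ (fun y => kernelCoord K l (y - x) - kernelCoord K l y) (2 ^ (m + 1) * R)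

/-- The class `H^†_{Φ,X}`: the norm of `X` is taken outside, after summing coordinatewise. -/
def HormanderDagger (Φ : ℝ≥0 → ℝ≥0∞) (K : EuclideanSpace ℝ (Fin n) → X) : Prop :=
  ∃ c : ℝ, 1 < c ∧ ∃ C : ℝ≥0, ∀ (x : EuclideanSpace ℝ (Fin n)) (R : ℝ), c * ‖x‖ < R →
    (∀ l, daggerEntry Φ K x R l ≠ ∞) ∧
      seqNorm X (fun l => (daggerEntry Φ K x R l).toReal) ≤ C

/-- `T` is of strong type `(p₀, p₀)` in the sense of Bochner-Lebesgue spaces: `Tf` is (a.e. equal to)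
a strongly measurable `X`-valued function `F` with `‖F‖_{L^{p₀}_X} ≤ C ‖f‖_{p₀}`, for `f` in the dense
class of bounded functions with compact support. -/
def StrongType (p₀ : ℝ) (K : EuclideanSpace ℝ (Fin n) → X) : Prop :=
  ∃ C : ℝ≥0, ∀ f : EuclideanSpace ℝ (Fin n) → ℝ, MemLInftyC f →
    ∃ F : EuclideanSpace ℝ (Fin n) → X, AEStronglyMeasurable F volume ∧
      (∀ᵐ x, BanachSequenceSpace.coord (F x) = singularIntegral K f x) ∧
      eLpNorm F (ENNReal.ofReal p₀) volume ≤ C * eLpNorm f (ENNReal.ofReal p₀) volume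

/-- `K` is the kernel of a vector-valued singular integral operator `T`. -/
structure IsSingularIntegralOperator (K : EuclideanSpace ℝ (Fin n) → X) : Prop where
  measurable : AEStronglyMeasurable K volume
  locallyIntegrable : ∀ l, LocallyIntegrableOn (kernelCoord K l) {0}ᶜ volume
  /-- the principal values defining `Tf` exist almost everywhere -/
  principalValue : ∀ f : EuclideanSpace ℝ (Fin n) → ℝ, MemLInftyC f → ∀ l, ∀ᵐ x,
    ∃ L : ℝ, Tendsto (truncInt K f l x) (𝓝[>] 0) (𝓝 L)
  strongType : ∃ p₀ : ℝ, 1 < p₀ ∧ StrongType p₀ K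
  /-- the kernel belongs to `H_{1,X}`, the class given by `t ↦ t` -/
  hormander : HormanderClass (fun t => (t : ℝ≥0∞)) K

end Kernel

end

/-! Write $S=M_{\overline{\mathcal A}}f$ and $g=\|Tf\|_X$. The estimate is a Fefferman–Stein
inequality in the style of John and Strömberg: mean oscillations are replaced by oscillations in
measure, so that every $p>0$ is allowed and only weak-type information on $T$ is needed.

The first half, `exists_oscillationBound`, shows that on a ball $B(x_0,r)$, outside a proportion
$\varepsilon$ of it, $g$ differs from a constant by at most $\Lambda(\varepsilon)t$ if $S(z)\le t$
for some $z$ in the ball. Split $f$ at distance $2cr$ from $x_0$. The near part is handled by the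
weak type $(1,1)$ of $T$ (`exists_weakType`, proved from $H_{1,X}$ and the strong type by a
Calderón–Zygmund decomposition), since Young's inequality bounds means of $|f|$ by $S(z)$. For the
far part $f_2$, each coordinate of $Tf_2(x)-Tf_2(x_0)$ is estimated by the generalized Hölder
inequality on dyadic annuli. The factor $S(z)$ is common to all coordinates; what remains is the
sequence in $H^\dagger_{\mathcal A,X}$, and monotonicity of the norm finishes.

The second half, `exists_lintegral_rpow_le_of_oscillationBound`, is a good-$\lambda$ argument. Let
$\Omega_t$ be the union of the balls more than half filled by $\{g>t\}$. On a Whitney ball of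
$\Omega_t$, the set $\Omega_{Dt}\cap\{S\le\gamma t\}$ fills at most half. The weight enters only
through `ComparableOnBalls`: a fixed Lebesgue proportion is a fixed $w$-proportion. Hence
$w(\Omega_t)\le C\,w(\Omega_t\setminus(\Omega_{Dt}\cap\{S\le\gamma t\}))$. Integrating against
$t^{p-1}$ with $D$ close to $1$ lets the $\Omega$ terms be absorbed, which is where finiteness of
the left-hand side is used. -/

/-! ### Comparison of measures on balls. -/

section Comparable

variable {V : Type*} [NormedAddCommGroup V] [MeasurableSpace V]

/-- `ν` is quantitatively nondegenerate with respect to `μ`: a set which fills a fixed proportion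
of a ball for `μ` fills a fixed proportion of this ball for `ν`. -/
def ComparableOnBalls (μ ν : Measure V) : Prop :=
  ∀ θ : ℝ≥0, 0 < θ → ∃ C : ℝ≥0, ∀ (c : V) (r : ℝ) (G : Set V), 0 < r → MeasurableSet G →
    G ⊆ Metric.ball c r → θ * μ (Metric.ball c r) ≤ μ G → ν (Metric.ball c r) ≤ C * ν G

theorem ComparableOnBalls.refl (μ : Measure V) : ComparableOnBalls μ μ := by
  refine fun θ hθ => ⟨θ⁻¹, fun c r G _ _ _ h => ?_⟩
  calc μ (Metric.ball c r) = (θ⁻¹ : ℝ≥0) * (θ * μ (Metric.ball c r)) := by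
        rw [← mul_assoc, ← ENNReal.coe_mul, inv_mul_cancel₀ hθ.ne', ENNReal.coe_one, one_mul]
    _ ≤ _ := by gcongr

end Comparable

/-! ### Vitali covering and the measure of unions of balls. -/

section Covering

variable {V : Type*} [NormedAddCommGroup V] [NormedSpace ℝ V] [FiniteDimensional ℝ V]

/-- Vitali's covering lemma for open balls. -/
theorem exists_countable_disjoint_subfamily_ball (t : Set (V × ℝ)) (hpos : ∀ b ∈ t, 0 < b.2)
    (R : ℝ) (hR : ∀ b ∈ t, b.2 ≤ R) :
    ∃ u ⊆ t, u.Countable ∧ (u.PairwiseDisjoint fun b => Metric.ball b.1 b.2) ∧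
      ⋃ b ∈ t, Metric.ball b.1 b.2 ⊆ ⋃ b ∈ u, Metric.ball b.1 (6 * b.2) := by
  obtain ⟨u, hut, hdisj, hcov⟩ :=
    Vitali.exists_disjoint_subfamily_covering_enlargement_closedBall t Prod.fst Prod.snd R hR
      5 (by norm_num)
  have hdisj' : u.PairwiseDisjoint fun b => Metric.ball b.1 b.2 :=
    hdisj.mono fun b => Metric.ball_subset_closedBall
  have : ProperSpace V := FiniteDimensional.proper_real V
  refine ⟨u, hut, hdisj'.countable_of_isOpen (fun _ _ => Metric.isOpen_ball)
    (fun b hb => Metric.nonempty_ball.2 (hpos b (hut hb))), hdisj', ?_⟩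
  refine Set.iUnion₂_subset fun b hb => ?_
  obtain ⟨a, ha, hba⟩ := hcov b hb
  refine Metric.ball_subset_closedBall.trans (hba.trans ?_)
  refine Set.Subset.trans ?_ (Set.subset_biUnion_of_mem ha)
  exact Metric.closedBall_subset_ball (by linarith [hpos a (hut ha)])

variable [MeasurableSpace V] [BorelSpace V]

/-- If every ball of a family has a dilate whose measure is controlled by the part of `G` in the
ball, then the measure of the union is controlled by the measure of `G`. -/
theorem measure_biUnion_ball_le (ν : Measure V) (C : ℝ≥0∞) (t : Set (V × ℝ)) (G : Set V)
    (hpos : ∀ b ∈ t, 0 < b.2)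
    (h : ∀ b ∈ t, ν (Metric.ball b.1 (6 * b.2)) ≤ C * ν (G ∩ Metric.ball b.1 b.2)) :
    ν (⋃ b ∈ t, Metric.ball b.1 b.2) ≤ C * ν G := by
  -- Vitali's lemma needs bounded radii; the full family is the increasing union over the bounds
  -- `m`.
  have key : ∀ m : ℕ, ν (⋃ b ∈ {b ∈ t | b.2 ≤ m}, Metric.ball b.1 b.2) ≤ C * ν G := by
    intro m
    obtain ⟨u, hut, huc, hdisj, hcov⟩ := exists_countable_disjoint_subfamily_ball
      {b ∈ t | b.2 ≤ m} (fun b hb => hpos b hb.1) m (fun b hb => hb.2)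
    have : Countable u := huc
    calc ν (⋃ b ∈ {b ∈ t | b.2 ≤ m}, Metric.ball b.1 b.2)
        ≤ ν (⋃ b ∈ u, Metric.ball b.1 (6 * b.2)) := measure_mono hcov
      _ ≤ ∑' b : u, ν (Metric.ball b.1.1 (6 * b.1.2)) := measure_biUnion_le _ huc _
      _ ≤ ∑' b : u, C * ν.restrict G (Metric.ball b.1.1 b.1.2) := by
          refine ENNReal.tsum_le_tsum fun b => ?_
          rw [Measure.restrict_apply measurableSet_ball, Set.inter_comm]
          exact h _ (hut b.2).1
      _ = C * ν.restrict G (⋃ b ∈ u, Metric.ball b.1 b.2) := by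
          rw [ENNReal.tsum_mul_left, measure_biUnion huc hdisj fun _ _ => measurableSet_ball]
      _ ≤ C * ν G := by
          gcongr C * ?_
          exact (measure_mono (Set.subset_univ _)).trans (Measure.restrict_apply_univ _).le
  have hmono : Monotone fun m : ℕ => ⋃ b ∈ {b ∈ t | b.2 ≤ m}, Metric.ball b.1 b.2 := by
    intro m k hmk
    refine Set.biUnion_subset_biUnion_left fun b hb => ⟨hb.1, hb.2.trans ?_⟩
    exact_mod_cast hmk
  have hU : (⋃ b ∈ t, Metric.ball b.1 b.2) =
      ⋃ m : ℕ, ⋃ b ∈ {b ∈ t | b.2 ≤ m}, Metric.ball b.1 b.2 := by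
    ext x
    simp only [Set.mem_iUnion, exists_prop, Set.mem_ofPred_eq]
    constructor
    · rintro ⟨b, hb, hx⟩
      obtain ⟨m, hm⟩ := exists_nat_ge b.2
      exact ⟨m, b, ⟨hb, hm⟩, hx⟩
    · rintro ⟨m, b, ⟨hb, -⟩, hx⟩
      exact ⟨b, hb, hx⟩
  rw [hU, hmono.measure_iUnion]
  exact iSup_le key

theorem ComparableOnBalls.measure_biUnion_le {μ ν : Measure V} [μ.IsAddHaarMeasure]
    (h : ComparableOnBalls μ ν) {θ : ℝ≥0} (hθ : 0 < θ) :
    ∃ C : ℝ≥0, ∀ (t : Set (V × ℝ)) (G : Set V), MeasurableSet G → (∀ b ∈ t, 0 < b.2) →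
      (∀ b ∈ t, θ * μ (Metric.ball b.1 b.2) ≤ μ (G ∩ Metric.ball b.1 b.2)) →
      ν (⋃ b ∈ t, Metric.ball b.1 b.2) ≤ C * ν G := by
  set d := Module.finrank ℝ V
  -- A proportion `θ` of a ball is a proportion `θ / 6 ^ d` of its Vitali dilate.
  obtain ⟨C, hC⟩ := h (θ * ((6 : ℝ≥0) ^ d)⁻¹) (by positivity)
  refine ⟨C, fun t G hG hpos ht => measure_biUnion_ball_le ν C t G hpos fun b hb => ?_⟩
  have hb0 := hpos b hb
  refine hC b.1 (6 * b.2) _ (by linarith) (hG.inter measurableSet_ball)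
    (Set.inter_subset_right.trans (Metric.ball_subset_ball (by linarith))) ?_
  refine le_trans (le_of_eq ?_) (ht b hb)
  rw [Measure.addHaar_ball_mul_of_pos μ b.1 (by norm_num : (0 : ℝ) < 6), Measure.addHaar_ball_center μ b.1 b.2]
  have : ENNReal.ofReal ((6 : ℝ) ^ d) = (((6 : ℝ≥0) ^ d : ℝ≥0) : ℝ≥0∞) := by
    rw [ENNReal.ofReal_pow (by norm_num)]; simp
  rw [this, ← mul_assoc, ← ENNReal.coe_mul, mul_assoc, inv_mul_cancel₀ (by positivity), mul_one]

end Covering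

/-! ### Muckenhoupt weights. -/

section Weights

variable {n : ℕ}

/-- The measure `w dx`. -/
noncomputable def weightMeasure (w : EuclideanSpace ℝ (Fin n) → ℝ) :
    Measure (EuclideanSpace ℝ (Fin n)) :=
  volume.withDensity fun x => ENNReal.ofReal (w x)

/-- Hölder's inequality with exponents $q$ and $q/(q-1)$ for $1=w^{1/q}w^{-1/q}$ on $G$. -/
theorem rpow_volume_le_of_pos {w : EuclideanSpace ℝ (Fin n) → ℝ} {q : ℝ} (hq : 1 < q)
    (hw : AEMeasurable w) {G B : Set (EuclideanSpace ℝ (Fin n))} (hGB : G ⊆ B)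
    (hs : ∫⁻ x in B, ENNReal.ofReal (w x) ^ (-(1 / (q - 1))) ≠ ∞) :
    volume G ^ q ≤ (∫⁻ x in G, ENNReal.ofReal (w x)) *
      (∫⁻ x in B, ENNReal.ofReal (w x) ^ (-(1 / (q - 1)))) ^ (q - 1) := by
  have hq0 : 0 < q := by linarith
  have hq1 : 0 < q - 1 := by linarith
  have hW : AEMeasurable (fun x => ENNReal.ofReal (w x)) := hw.ennreal_ofReal
  have hWG : AEMeasurable (fun x => ENNReal.ofReal (w x)) (volume.restrict G) := hW.restrict
  have hs' : ∫⁻ x in G, ENNReal.ofReal (w x) ^ (-(1 / (q - 1))) ≠ ∞ :=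
    ((lintegral_mono_set hGB).trans_lt (lt_top_iff_ne_top.2 hs)).ne
  have hconj : q.HolderConjugate (q / (q - 1)) := by
    rw [Real.holderConjugate_iff]
    refine ⟨hq, ?_⟩
    field_simp
    ring
  have hH := ENNReal.lintegral_mul_le_Lp_mul_Lq (volume.restrict G) hconj
    (hWG.pow_const (1 / q)) (hWG.pow_const (-(1 / q)))
  -- The product is $1$ only where $w>0$; zeros of $w$ are negligible because there the integrand in
  -- `hs'` is infinite.
  have h1 : ∫⁻ x in G, ((fun x => ENNReal.ofReal (w x) ^ (1 / q)) *
      fun x => ENNReal.ofReal (w x) ^ (-(1 / q))) x = volume G := by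
    rw [← setLIntegral_one]
    refine lintegral_congr_ae ?_
    filter_upwards [ae_lt_top' (hWG.pow_const _) hs'] with x hx
    have h0 : ENNReal.ofReal (w x) ≠ 0 := by
      intro h
      rw [h, ENNReal.zero_rpow_of_neg (by simp; exact hq)] at hx
      exact absurd hx (lt_irrefl _)
    simp only [Pi.mul_apply]
    rw [← ENNReal.rpow_add _ _ h0 ENNReal.ofReal_ne_top, add_neg_cancel, ENNReal.rpow_zero]
  have h2 : ∀ x, (ENNReal.ofReal (w x) ^ (1 / q)) ^ q = ENNReal.ofReal (w x) := by
    intro x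
    rw [← ENNReal.rpow_mul, one_div_mul_cancel hq0.ne', ENNReal.rpow_one]
  have h3 : ∀ x, (ENNReal.ofReal (w x) ^ (-(1 / q))) ^ (q / (q - 1)) =
      ENNReal.ofReal (w x) ^ (-(1 / (q - 1))) := by
    intro x
    rw [← ENNReal.rpow_mul]
    congr 1
    field_simp
  rw [h1] at hH
  simp only [h2, h3] at hH
  calc volume G ^ q ≤ _ := ENNReal.rpow_le_rpow hH hq0.le
    _ = (∫⁻ x in G, ENNReal.ofReal (w x)) *
      (∫⁻ x in G, ENNReal.ofReal (w x) ^ (-(1 / (q - 1)))) ^ (q - 1) := by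
        rw [ENNReal.mul_rpow_of_nonneg _ _ hq0.le, ← ENNReal.rpow_mul, ← ENNReal.rpow_mul,
          one_div_mul_cancel hq0.ne', ENNReal.rpow_one]
        congr 2
        field_simp
    _ ≤ _ := by gcongr

/-- Hölder's inequality and the $A_q$ condition give $(|G|/|B|)^q\,w(B)\le C\,w(G)$. -/
theorem MuckenhouptA.comparableOnBalls {q : ℝ} (hq : 1 < q) {w : EuclideanSpace ℝ (Fin n) → ℝ}
    (hw : MuckenhouptA q w) : ComparableOnBalls volume (weightMeasure w) := by
  obtain ⟨-, hloc, C, hC⟩ := hw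
  have hq0 : 0 < q := by linarith
  have hq1 : 0 < q - 1 := by linarith
  refine fun θ hθ => ⟨C * (θ⁻¹) ^ q, fun c r G hr hG hGB hθG => ?_⟩
  rw [weightMeasure, withDensity_apply _ measurableSet_ball, withDensity_apply _ hG]
  have hA := hC c r hr
  set B := Metric.ball c r
  set v := volume B
  have hv0 : v ≠ 0 := (Metric.measure_ball_pos volume c hr).ne'
  have hvt : v ≠ ∞ := measure_ball_lt_top.ne
  set b := ∫⁻ x in B, ENNReal.ofReal (w x)
  set s := ∫⁻ x in B, ENNReal.ofReal (w x) ^ (-(1 / (q - 1))) with hs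
  -- An infinite `s` contradicts the $A_q$ bound only when $w(B)>0$, as $0\cdot\infty=0$.
  by_cases hb : b = 0
  · rw [hb]; exact zero_le
  have hvi0 : v⁻¹ ≠ 0 := ENNReal.inv_ne_zero.2 hvt
  have hvit : v⁻¹ ≠ ∞ := ENNReal.inv_ne_top.2 hv0
  have hst : s ≠ ∞ := by
    intro h
    rw [h, ENNReal.mul_top hvi0, ENNReal.top_rpow_of_pos hq1,
      ENNReal.mul_top (mul_ne_zero hvi0 hb)] at hA
    exact absurd hA (by simp)
  have h1 := rpow_volume_le_of_pos hq hloc.aestronglyMeasurable.aemeasurable hGB hst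
  rw [← hs] at h1
  set e := ∫⁻ x in G, ENNReal.ofReal (w x)
  have hvq : v ^ q ≠ 0 := by simp [hv0, hvt]
  have hvqt : v ^ q ≠ ∞ := ENNReal.rpow_ne_top_of_nonneg hq0.le hvt
  have h2 : b * s ^ (q - 1) ≤ C * v ^ q := by
    rw [ENNReal.mul_rpow_of_nonneg _ _ hq1.le] at hA
    have : v⁻¹ * b * (v⁻¹ ^ (q - 1) * s ^ (q - 1)) = (v ^ q)⁻¹ * (b * s ^ (q - 1)) := by
      have : (v ^ q)⁻¹ = v⁻¹ * v⁻¹ ^ (q - 1) := by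
        rw [← ENNReal.inv_rpow]
        conv_rhs => rw [← ENNReal.rpow_one v⁻¹, ← ENNReal.rpow_mul,
          ← ENNReal.rpow_add _ _ hvi0 hvit]
        congr 1
        ring
      rw [this]; ring
    rw [this] at hA
    rw [mul_comm (C : ℝ≥0∞), ← ENNReal.inv_mul_le_iff hvq hvqt]
    exact hA
  have h3 : (θ : ℝ≥0∞) ^ q * v ^ q * b ≤ e * C * v ^ q := by
    rw [← ENNReal.mul_rpow_of_nonneg _ _ hq0.le]
    calc (θ * v) ^ q * b ≤ volume G ^ q * b := by gcongr
      _ ≤ e * s ^ (q - 1) * b := by gcongr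
      _ = e * (b * s ^ (q - 1)) := by ring
      _ ≤ e * (C * v ^ q) := by gcongr
      _ = _ := by ring
  have h4 : (θ : ℝ≥0∞) ^ q * b ≤ e * C := by
    rw [mul_right_comm] at h3
    exact (ENNReal.mul_le_mul_iff_left hvq hvqt).1 h3
  have hθq : (θ : ℝ≥0∞) ^ q ≠ 0 := by simp [hθ.ne']
  have hθqt : (θ : ℝ≥0∞) ^ q ≠ ∞ := ENNReal.rpow_ne_top_of_nonneg hq0.le ENNReal.coe_ne_top
  have h5 : (((C * (θ⁻¹) ^ q : ℝ≥0)) : ℝ≥0∞) = C * ((θ : ℝ≥0∞) ^ q)⁻¹ := by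
    rw [ENNReal.coe_mul, ENNReal.coe_rpow_of_nonneg _ hq0.le, ENNReal.coe_inv hθ.ne',
      ENNReal.inv_rpow]
  rw [h5, mul_assoc, mul_comm (C : ℝ≥0∞), mul_assoc]
  rwa [← ENNReal.inv_mul_le_iff (by simpa using hθqt) (by simpa using hθq), inv_inv]

end Weights

/-! ### The good-$\lambda$ inequality. -/

section GoodLambda

variable {V : Type*} [NormedAddCommGroup V] [MeasurableSpace V]

/-- The union of the balls of which `F` fills more than a half. -/
def densitySet (μ : Measure V) (F : Set V) : Set V :=
  ⋃ b ∈ {b : V × ℝ | 0 < b.2 ∧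
    ((2⁻¹ : ℝ≥0) : ℝ≥0∞) * μ (Metric.ball b.1 b.2) < μ (F ∩ Metric.ball b.1 b.2)},
    Metric.ball b.1 b.2

theorem isOpen_densitySet (μ : Measure V) (F : Set V) : IsOpen (densitySet μ F) :=
  isOpen_biUnion fun _ _ => Metric.isOpen_ball

theorem densitySet_mono (μ : Measure V) {F G : Set V} (h : F ⊆ G) :
    densitySet μ F ⊆ densitySet μ G :=
  Set.biUnion_subset_biUnion_left fun _ hb =>
    ⟨hb.1, hb.2.trans_le (measure_mono (Set.inter_subset_inter_left _ h))⟩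

theorem measure_inter_ball_le_of_notMem_densitySet {μ : Measure V} {F : Set V} {c y : V} {r : ℝ}
    (hy : y ∈ Metric.ball c r) (h : y ∉ densitySet μ F) :
    μ (F ∩ Metric.ball c r) ≤ ((2⁻¹ : ℝ≥0) : ℝ≥0∞) * μ (Metric.ball c r) := by
  by_contra! hlt
  exact h (Set.mem_biUnion (x := (c, r)) ⟨Metric.pos_of_mem_ball hy, hlt⟩ hy)

/-- The function `g` deviates on every ball from a suitable constant by more than `Λ t` only on a
proportion `ε` of the ball, if `S ≤ t` somewhere on the ball. -/
def OscillationBound (μ : Measure V) (g : V → ℝ) (S : V → ℝ≥0∞) (ε : ℝ≥0) (Λ : ℝ) : Prop :=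
  ∀ (c z : V) (r t : ℝ), 0 < t → z ∈ Metric.ball c r → S z ≤ ENNReal.ofReal t →
    ∃ a : ℝ, μ {x ∈ Metric.ball c r | Λ * t < |g x - a|} ≤ ε * μ (Metric.ball c r)

variable [NormedSpace ℝ V] [FiniteDimensional ℝ V]

/-- Since $y\notin\Omega_t$, at least half of the ball has $g\le t$, and as $\varepsilon<1/2$ some
such point is also $\Lambda\gamma t$-close to the constant $a$. Thus $a\le(1+\Lambda\gamma)t$, and
$g>Dt$ forces a deviation above $\Lambda\gamma t$. No lower bound on $D-1$ is needed beyond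
$2\Lambda\gamma$. -/
theorem OscillationBound.measure_inter_ball_le {μ : Measure V} [μ.IsAddHaarMeasure] {g : V → ℝ}
    {S : V → ℝ≥0∞} {ε : ℝ≥0} {Λ γ D t r : ℝ} {c y z : V}
    (h : OscillationBound μ g S ε Λ) (hε : ε < 2⁻¹) (hγ : 0 < γ) (ht : 0 < t)
    (hD : 1 + 2 * Λ * γ ≤ D) (hy : y ∈ Metric.ball c r) (hyd : y ∉ densitySet μ {x | t < g x})
    (hz : z ∈ Metric.ball c r) (hSz : S z ≤ ENNReal.ofReal (γ * t)) :
    μ ({x | D * t < g x} ∩ Metric.ball c r) ≤ ε * μ (Metric.ball c r) := by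
  have hr := Metric.pos_of_mem_ball hy
  obtain ⟨a, ha⟩ := h c z r (γ * t) (by positivity) hz hSz
  have hex : ∃ x ∈ Metric.ball c r, g x ≤ t ∧ |g x - a| ≤ Λ * (γ * t) := by
    by_contra! hno
    have hsub : Metric.ball c r ⊆ ({x | t < g x} ∩ Metric.ball c r) ∪
        {x ∈ Metric.ball c r | Λ * (γ * t) < |g x - a|} := by
      intro x hx
      rcases lt_or_ge t (g x) with h1 | h1
      · exact Or.inl ⟨h1, hx⟩
      · exact Or.inr ⟨hx, hno x hx h1⟩
    have hle := (measure_mono hsub).trans ((measure_union_le _ _).trans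
      (add_le_add (measure_inter_ball_le_of_notMem_densitySet hy hyd) ha))
    rw [← add_mul, ← ENNReal.coe_add] at hle
    have hlt : (((2⁻¹ + ε : ℝ≥0)) : ℝ≥0∞) < 1 := by
      rw [ENNReal.coe_lt_one_iff]
      calc (2⁻¹ + ε : ℝ≥0) < 2⁻¹ + 2⁻¹ := by gcongr
        _ = 1 := by rw [← two_mul]; exact mul_inv_cancel₀ two_ne_zero
    have := ENNReal.mul_lt_mul_left (Metric.measure_ball_pos μ c hr).ne'
      measure_ball_lt_top.ne hlt
    rw [one_mul] at this
    exact absurd hle (not_le.2 this)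
  obtain ⟨x₀, hx₀, h1, h2⟩ := hex
  refine (measure_mono ?_).trans ha
  rintro x ⟨hx : D * t < g x, hxb⟩
  refine ⟨hxb, lt_of_lt_of_le ?_ (le_abs_self _)⟩
  have h3 := (abs_le.1 h2).1
  have h4 : (1 + 2 * Λ * γ) * t ≤ D * t := by gcongr
  nlinarith

variable [BorelSpace V]

/-- The balls defining the density set satisfy the covering lemma with proportion one half. For `ν`
this plays the role of a weighted maximal theorem. -/
theorem exists_measure_densitySet_le {μ ν : Measure V} [μ.IsAddHaarMeasure]
    (h : ComparableOnBalls μ ν) :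
    ∃ C : ℝ≥0, ∀ F : Set V, MeasurableSet F → ν (densitySet μ F) ≤ C * ν F := by
  obtain ⟨C, hC⟩ := h.measure_biUnion_le (θ := 2⁻¹) (by positivity)
  exact ⟨C, fun F hF => hC _ F hF (fun b hb => hb.1) fun b hb => hb.2.le⟩

/-- Lebesgue's density theorem; nontriviality makes spheres null, so closed balls may be replaced by
open ones. -/
theorem ae_mem_densitySet [Nontrivial V] (μ : Measure V) [μ.IsAddHaarMeasure] (F : Set V) :
    ∀ᵐ x ∂μ.restrict F, x ∈ densitySet μ F := by
  have : ProperSpace V := FiniteDimensional.proper_real V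
  filter_upwards [Besicovitch.ae_tendsto_measure_inter_div μ F] with x hx
  have h2 : (((2⁻¹ : ℝ≥0) : ℝ≥0∞)) < 1 := by
    rw [ENNReal.coe_lt_one_iff]; exact inv_lt_one_of_one_lt₀ one_lt_two
  obtain ⟨r, hr, hr0 : 0 < r⟩ :=
    ((hx.eventually (lt_mem_nhds h2)).and self_mem_nhdsWithin).exists
  refine Set.mem_biUnion (x := (x, r)) ⟨hr0, ?_⟩ (Metric.mem_ball_self hr0)
  rw [ENNReal.lt_div_iff_mul_lt (Or.inl (Metric.measure_closedBall_pos μ x hr0).ne')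
    (Or.inl measure_closedBall_lt_top.ne), Measure.addHaar_closedBall_eq_addHaar_ball] at hr
  refine hr.trans_le ?_
  have hae : (F ∩ Metric.closedBall x r : Set V) ≤ᵐ[μ] (F ∩ Metric.ball x r : Set V) := by
    have hs : ∀ᵐ y ∂μ, y ∉ Metric.sphere x r := measure_eq_zero_iff_ae_notMem.1
      (Measure.addHaar_sphere μ x r)
    filter_upwards [hs] with y hy hyF
    exact ⟨hyF.1, lt_of_le_of_ne hyF.2 hy⟩
  exact measure_mono_ae hae

/-- The complement of $B(0,k)$ fills half of every ball $B(0,r)$ with $r\ge2k$, so it carries a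
fixed proportion of the whole `ν`-mass. For finite `ν` this mass tends to $0$ as $k\to\infty$. -/
theorem ComparableOnBalls.eq_zero_of_measure_univ_ne_top [Nontrivial V] {μ ν : Measure V}
    [μ.IsAddHaarMeasure] (h : ComparableOnBalls μ ν) (hν : ν Set.univ ≠ ∞) : ν = 0 := by
  obtain ⟨C, hC⟩ := h.measure_biUnion_le (θ := 2⁻¹) (by positivity)
  have key : ∀ k : ℕ, ν Set.univ ≤ C * ν (Metric.ball 0 k)ᶜ := by
    intro k
    have := hC {b | b.1 = 0 ∧ 2 * k ≤ b.2 ∧ 0 < b.2} (Metric.ball 0 (k : ℝ))ᶜ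
      measurableSet_ball.compl (fun b hb => hb.2.2) ?_
    · refine le_trans (measure_mono fun x _ => ?_) this
      have hx : ‖x‖ < ‖x‖ + 2 * k + 1 := by linarith [Nat.cast_nonneg (α := ℝ) k]
      exact Set.mem_biUnion (x := (0, ‖x‖ + 2 * k + 1)) ⟨rfl, by simp only; linarith [norm_nonneg x], by positivity⟩
        (by simpa using hx)
    · rintro ⟨c, r⟩ ⟨hc, hr, hr0⟩
      simp only at hc hr hr0
      subst hc
      have h1 : μ (Metric.ball (0 : V) k) ≤ ((2⁻¹ : ℝ≥0) : ℝ≥0∞) * μ (Metric.ball 0 r) := by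
        have hk : Metric.ball (0 : V) k ⊆ Metric.ball 0 (2⁻¹ * r) :=
          Metric.ball_subset_ball (by linarith)
        refine (measure_mono hk).trans ?_
        rw [Measure.addHaar_ball_mul_of_pos μ _ (by norm_num)]
        gcongr
        rw [ENNReal.ofReal_le_iff_le_toReal ENNReal.coe_ne_top]
        simp only [ENNReal.coe_toReal, NNReal.coe_inv, NNReal.coe_ofNat]
        exact pow_le_of_le_one (by norm_num) (by norm_num) Module.finrank_pos.ne'
      have h2 : μ (Metric.ball (0 : V) r) ≤ μ (Metric.ball (0 : V) k) +
          μ ((Metric.ball (0 : V) k)ᶜ ∩ Metric.ball 0 r) := by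
        refine le_trans (measure_mono fun x hx => ?_) (measure_union_le _ _)
        by_cases hxk : x ∈ Metric.ball (0 : V) k
        · exact Or.inl hxk
        · exact Or.inr ⟨hxk, hx⟩
      have h3 : ((2⁻¹ : ℝ≥0) : ℝ≥0∞) * μ (Metric.ball (0 : V) r) +
          ((2⁻¹ : ℝ≥0) : ℝ≥0∞) * μ (Metric.ball (0 : V) r) = μ (Metric.ball (0 : V) r) := by
        rw [← add_mul, ← ENNReal.coe_add]
        have : (2⁻¹ + 2⁻¹ : ℝ≥0) = 1 := by rw [← two_mul]; exact mul_inv_cancel₀ two_ne_zero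
        rw [this]; simp
      have hfin : ((2⁻¹ : ℝ≥0) : ℝ≥0∞) * μ (Metric.ball (0 : V) r) ≠ ∞ :=
        ENNReal.mul_ne_top ENNReal.coe_ne_top measure_ball_lt_top.ne
      refine (ENNReal.add_le_add_iff_left hfin).1 ?_
      rw [h3]
      exact h2.trans (by gcongr)
  have hlim : Tendsto (fun k : ℕ => C * ν (Metric.ball (0 : V) k)ᶜ) atTop (𝓝 (C * 0)) := by
    refine ENNReal.Tendsto.const_mul ?_ (Or.inr ENNReal.coe_ne_top)
    have : (⋂ k : ℕ, (Metric.ball (0 : V) k)ᶜ) = ∅ := by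
      ext x
      obtain ⟨k, hk⟩ := exists_nat_gt ‖x‖
      simp only [Set.mem_iInter, Set.mem_compl_iff, Set.mem_empty_iff_false, iff_false, not_forall,
        not_not]
      exact ⟨k, by simpa using hk⟩
    rw [← measure_empty (μ := ν), ← this]
    refine tendsto_measure_iInter_atTop (fun k => measurableSet_ball.compl.nullMeasurableSet) ?_
      ⟨0, (measure_lt_top_of_subset (Set.subset_univ _) hν).ne⟩
    intro k m hkm
    exact Set.compl_subset_compl.2 (Metric.ball_subset_ball (by exact_mod_cast hkm))
  have h0 : ν Set.univ ≤ C * 0 := ge_of_tendsto' hlim key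
  simpa using h0

/-- On a Whitney ball of radius $d$, only $\{g>Dt\}$ inside the triple ball matters. That ball meets
$\Omega_t^c$ and contains `z`, so the set is a small proportion of it, and the weak-type bound for
density sets applies. -/
theorem OscillationBound.measure_densitySet_inter_ball_le {μ : Measure V} [μ.IsAddHaarMeasure]
    {g : V → ℝ} {S : V → ℝ≥0∞} {ε C : ℝ≥0} {Λ γ D t : ℝ} {x z : V}
    (h : OscillationBound μ g S ε Λ) (hg : Measurable g)
    (hC : ∀ F : Set V, MeasurableSet F → μ (densitySet μ F) ≤ C * μ F)
    (hε : ε * (4 : ℝ≥0) ^ Module.finrank ℝ V < 2⁻¹)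
    (hεC : C * (ε * (3 : ℝ≥0) ^ Module.finrank ℝ V) ≤ 2⁻¹) (hγ : 0 < γ) (ht : 0 < t)
    (hD : 1 + 2 * Λ * γ ≤ D)
    (hne : densitySet μ {x | t < g x} ≠ Set.univ)
    (hz : z ∈ Metric.ball x (Metric.infDist x (densitySet μ {x | t < g x})ᶜ))
    (hSz : S z ≤ ENNReal.ofReal (γ * t)) :
    μ (densitySet μ {x | D * t < g x} ∩
        Metric.ball x (Metric.infDist x (densitySet μ {x | t < g x})ᶜ)) ≤
      ((2⁻¹ : ℝ≥0) : ℝ≥0∞) *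
        μ (Metric.ball x (Metric.infDist x (densitySet μ {x | t < g x})ᶜ)) := by
  have hscale : ∀ (k : ℝ≥0) (c : V) (r : ℝ), 0 < k → μ (Metric.ball c (k * r)) =
      ((k ^ Module.finrank ℝ V : ℝ≥0) : ℝ≥0∞) * μ (Metric.ball c r) := by
    intro k c r hk
    rw [Measure.addHaar_ball_mul_of_pos μ _ (NNReal.coe_pos.2 hk), ← Measure.addHaar_ball_center μ c,
      ← NNReal.coe_pow, ENNReal.ofReal_coe_nnreal]
  set Ω := densitySet μ {x | t < g x} with hΩ
  set d := Metric.infDist x Ωᶜ with hd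
  have hd0 : 0 < d := Metric.pos_of_mem_ball hz
  obtain ⟨y, hyΩ, hxy⟩ : ∃ y ∈ Ωᶜ, dist x y < 2 * d :=
    (Metric.infDist_lt_iff (Set.nonempty_compl.2 hne)).1 (by linarith)
  have hε2 : ε < 2⁻¹ := lt_of_le_of_lt (le_mul_of_one_le_right zero_le
    (one_le_pow₀ (by norm_num))) hε
  have hzx : dist z x < d := hz
  set F := {x | D * t < g x} ∩ Metric.ball x (3 * d) with hF
  have hFm : MeasurableSet F := (measurableSet_lt measurable_const hg).inter measurableSet_ball
  have hsub : densitySet μ {x | D * t < g x} ∩ Metric.ball x d ⊆ densitySet μ F := by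
    rintro x' ⟨hx', hx'd⟩
    obtain ⟨⟨c, r⟩, ⟨hr, hb⟩, hx'c⟩ := Set.mem_iUnion₂.1 hx'
    simp only at hr hb hx'c
    have hx'd' : dist x' x < d := hx'd
    have hx'c' : dist x' c < r := hx'c
    -- A ball with $r<d$ stays within distance $3d$ of $x$. A ball with $r\ge d$ has a fourfold
    -- dilate containing both `y` and `z`, so $\{g>Dt\}$ fills less than half of it: such a ball
    -- does not occur.
    rcases lt_or_ge r d with hrd | hrd
    · refine Set.mem_biUnion (x := (c, r)) ⟨hr, hb.trans_le (measure_mono ?_)⟩ hx'c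
      rintro u ⟨hu, huc⟩
      refine ⟨⟨hu, ?_⟩, huc⟩
      have huc' : dist u c < r := huc
      have h1 := dist_triangle u c x'
      have h2 := dist_triangle u x' x
      rw [dist_comm c x'] at h1
      show dist u x < 3 * d
      linarith
    · exfalso
      have hyc : y ∈ Metric.ball c (4 * r) := by
        have h1 := dist_triangle y x c
        have h2 := dist_triangle x x' c
        rw [dist_comm y x] at h1
        rw [dist_comm x x'] at h2
        show dist y c < 4 * r
        linarith
      have hzc : z ∈ Metric.ball c (4 * r) := by
        have h1 := dist_triangle z x c
        have h2 := dist_triangle x x' c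
        rw [dist_comm x x'] at h2
        show dist z c < 4 * r
        linarith
      have h3 := h.measure_inter_ball_le hε2 hγ ht hD hyc hyΩ hzc hSz
      have h4 : μ ({x | D * t < g x} ∩ Metric.ball c r) ≤
          ((ε * (4 : ℝ≥0) ^ Module.finrank ℝ V : ℝ≥0) : ℝ≥0∞) * μ (Metric.ball c r) := by
        refine (measure_mono (Set.inter_subset_inter_right _
          (Metric.ball_subset_ball (by linarith)))).trans (h3.trans ?_)
        have := hscale 4 c r (by norm_num)
        rw [NNReal.coe_ofNat] at this
        rw [this, ENNReal.coe_mul, mul_assoc]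
      refine absurd (hb.trans_le h4) (not_lt.2 ?_)
      gcongr
  have h5 : μ F ≤ ((ε * (3 : ℝ≥0) ^ Module.finrank ℝ V : ℝ≥0) : ℝ≥0∞) * μ (Metric.ball x d) := by
    have hy3 : y ∈ Metric.ball x (3 * d) := by
      rw [Metric.mem_ball, dist_comm]
      linarith
    have hz3 : z ∈ Metric.ball x (3 * d) := lt_trans hzx (by linarith)
    refine (h.measure_inter_ball_le hε2 hγ ht hD hy3 hyΩ hz3 hSz).trans ?_
    have := hscale 3 x d (by norm_num)
    rw [NNReal.coe_ofNat] at this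
    rw [this, ENNReal.coe_mul, mul_assoc]
  calc μ (densitySet μ {x | D * t < g x} ∩ Metric.ball x d) ≤ μ (densitySet μ F) :=
        measure_mono hsub
    _ ≤ C * μ F := hC F hFm
    _ ≤ C * (((ε * (3 : ℝ≥0) ^ Module.finrank ℝ V : ℝ≥0) : ℝ≥0∞) * μ (Metric.ball x d)) := by
        gcongr
    _ = ((C * (ε * (3 : ℝ≥0) ^ Module.finrank ℝ V) : ℝ≥0) : ℝ≥0∞) * μ (Metric.ball x d) := by
        push_cast; ring
    _ ≤ _ := by gcongr

/-- The good-`λ` inequality: a fixed proportion of the set `{M g > t}` lies outside of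
`{M g > D t, S ≤ γ t}`. -/
theorem OscillationBound.measure_densitySet_le {μ ν : Measure V} [μ.IsAddHaarMeasure]
    {g : V → ℝ} {S : V → ℝ≥0∞} {ε C C' : ℝ≥0} {Λ γ D t : ℝ}
    (h : OscillationBound μ g S ε Λ) (hg : Measurable g) (hS : LowerSemicontinuous S)
    (hC : ∀ F : Set V, MeasurableSet F → μ (densitySet μ F) ≤ C * μ F)
    (hC' : ∀ (t : Set (V × ℝ)) (G : Set V), MeasurableSet G → (∀ b ∈ t, 0 < b.2) →
      (∀ b ∈ t, ((2⁻¹ : ℝ≥0) : ℝ≥0∞) * μ (Metric.ball b.1 b.2) ≤ μ (G ∩ Metric.ball b.1 b.2)) →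
      ν (⋃ b ∈ t, Metric.ball b.1 b.2) ≤ C' * ν G)
    (hε : ε * (4 : ℝ≥0) ^ Module.finrank ℝ V < 2⁻¹)
    (hεC : C * (ε * (3 : ℝ≥0) ^ Module.finrank ℝ V) ≤ 2⁻¹) (hγ : 0 < γ) (ht : 0 < t)
    (hD : 1 + 2 * Λ * γ ≤ D) (hne : densitySet μ {x | t < g x} ≠ Set.univ) :
    ν (densitySet μ {x | t < g x}) ≤ C' * ν (densitySet μ {x | t < g x} \
      (densitySet μ {x | D * t < g x} ∩ {x | S x ≤ ENNReal.ofReal (γ * t)})) := by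
  set Ω := densitySet μ {x | t < g x} with hΩ
  set E := densitySet μ {x | D * t < g x} ∩ {x | S x ≤ ENNReal.ofReal (γ * t)} with hE
  have hΩo : IsOpen Ω := isOpen_densitySet _ _
  have hpos : ∀ x ∈ Ω, 0 < Metric.infDist x Ωᶜ := by
    intro x hx
    exact (hΩo.isClosed_compl.notMem_iff_infDist_pos (Set.nonempty_compl.2 hne)).1 (by simpa)
  have hEm : MeasurableSet E := (isOpen_densitySet _ _).measurableSet.inter
    (measurableSet_le hS.measurable measurable_const)
  refine le_trans (measure_mono ?_) (hC' ((fun x => (x, Metric.infDist x Ωᶜ)) '' Ω) _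
    (hΩo.measurableSet.diff hEm) ?_ ?_)
  · intro x hx
    exact Set.mem_biUnion (Set.mem_image_of_mem _ hx) (Metric.mem_ball_self (hpos x hx))
  · rintro _ ⟨x, hx, rfl⟩
    exact hpos x hx
  · rintro _ ⟨x, hx, rfl⟩
    simp only
    set B := Metric.ball x (Metric.infDist x Ωᶜ) with hB
    have hBΩ : B ⊆ Ω := Metric.ball_infDist_compl_subset
    have hEB : μ (E ∩ B) ≤ ((2⁻¹ : ℝ≥0) : ℝ≥0∞) * μ B := by
      by_cases hz : ∃ z ∈ B, S z ≤ ENNReal.ofReal (γ * t)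
      · obtain ⟨z, hzB, hz⟩ := hz
        exact (measure_mono (Set.inter_subset_inter_left _ Set.inter_subset_left)).trans
          (h.measure_densitySet_inter_ball_le hg hC hε hεC hγ ht hD hne hzB hz)
      · have : E ∩ B = ∅ := by
          ext z
          simp only [Set.mem_inter_iff, Set.mem_empty_iff_false, iff_false, not_and]
          exact fun hzE hzB => hz ⟨z, hzB, hzE.2⟩
        rw [this, measure_empty]
        exact zero_le
    have hsplit : μ B ≤ μ (E ∩ B) + μ ((Ω \ E) ∩ B) := by
      refine (measure_mono fun y hy => ?_).trans (measure_union_le _ _)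
      by_cases hyE : y ∈ E
      · exact Or.inl ⟨hyE, hy⟩
      · exact Or.inr ⟨⟨hBΩ hy, hyE⟩, hy⟩
    have h3 : ((2⁻¹ : ℝ≥0) : ℝ≥0∞) * μ B + ((2⁻¹ : ℝ≥0) : ℝ≥0∞) * μ B = μ B := by
      rw [← add_mul, ← ENNReal.coe_add]
      have : (2⁻¹ + 2⁻¹ : ℝ≥0) = 1 := by rw [← two_mul]; exact mul_inv_cancel₀ two_ne_zero
      rw [this]; simp
    have hfin : ((2⁻¹ : ℝ≥0) : ℝ≥0∞) * μ B ≠ ∞ :=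
      ENNReal.mul_ne_top ENNReal.coe_ne_top measure_ball_lt_top.ne
    refine (ENNReal.add_le_add_iff_left hfin).1 ?_
    rw [h3]
    exact hsplit.trans (by gcongr)

end GoodLambda

/-! ### Scaling and the layer cake formula. -/

section Integration

theorem lintegral_Ioi_comp_mul_left {D : ℝ} (hD : 0 < D) (F : ℝ → ℝ≥0∞) :
    ∫⁻ t in Set.Ioi 0, F t = ENNReal.ofReal D * ∫⁻ t in Set.Ioi 0, F (D * t) := by
  rw [← lintegral_indicator measurableSet_Ioi, ← lintegral_indicator measurableSet_Ioi]
  conv_lhs => rw [← Real.smul_map_volume_mul_left hD.ne']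
  rw [lintegral_smul_measure, abs_of_pos hD, smul_eq_mul]
  congr 1
  have := (Homeomorph.mulLeft₀ D hD.ne').measurableEmbedding.lintegral_map (μ := volume)
    ((Set.Ioi 0).indicator F)
  simp only [Homeomorph.coe_mulLeft₀] at this
  rw [this]
  refine lintegral_congr fun t => ?_
  by_cases ht : 0 < t
  · rw [Set.indicator_of_mem (Set.mem_Ioi.2 (mul_pos hD ht)), Set.indicator_of_mem (Set.mem_Ioi.2 ht)]
  · rw [Set.indicator_of_notMem, Set.indicator_of_notMem (by simpa using ht)]
    simpa using not_lt.1 fun h => ht (pos_of_mul_pos_right h hD.le |> fun h => h)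

theorem lintegral_Ioi_comp_mul_left_rpow {D p : ℝ} (hD : 0 < D) (F : ℝ → ℝ≥0∞) :
    ∫⁻ t in Set.Ioi 0, F t * ENNReal.ofReal (t ^ (p - 1)) =
      ENNReal.ofReal (D ^ p) * ∫⁻ t in Set.Ioi 0, F (D * t) * ENNReal.ofReal (t ^ (p - 1)) := by
  rw [lintegral_Ioi_comp_mul_left hD]
  have : ∀ t ∈ Set.Ioi (0 : ℝ), F (D * t) * ENNReal.ofReal ((D * t) ^ (p - 1)) =
      ENNReal.ofReal (D ^ (p - 1)) * (F (D * t) * ENNReal.ofReal (t ^ (p - 1))) := by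
    intro t ht
    rw [Real.mul_rpow hD.le (le_of_lt ht), ENNReal.ofReal_mul (by positivity)]
    ring
  rw [setLIntegral_congr_fun measurableSet_Ioi this,
    lintegral_const_mul' _ _ ENNReal.ofReal_ne_top, ← mul_assoc, ← ENNReal.ofReal_mul hD.le]
  congr 2
  rw [Real.rpow_sub_one hD.ne']
  field_simp

/-- The layer cake formula for functions with values in `[0,∞]`, with a scaling parameter. -/
theorem lintegral_Ioi_measure_lt_mul_rpow_le {α : Type*} [MeasurableSpace α] (ν : Measure α)
    {S : α → ℝ≥0∞} (hS : Measurable S) {p γ : ℝ} (hp : 0 < p) (hγ : 0 < γ) :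
    ENNReal.ofReal p * ∫⁻ t in Set.Ioi 0, ν {x | ENNReal.ofReal (γ * t) < S x} *
      ENNReal.ofReal (t ^ (p - 1)) ≤ ENNReal.ofReal (γ ^ (-p)) * ∫⁻ x, S x ^ p ∂ν := by
  by_cases htop : ∫⁻ x, S x ^ p ∂ν = ∞
  · rw [htop, ENNReal.mul_top (by simp; positivity)]
    exact le_top
  have hae : ∀ᵐ x ∂ν, S x ≠ ∞ := by
    filter_upwards [ae_lt_top (hS.pow_const p) htop] with x hx h
    rw [h, ENNReal.top_rpow_of_pos hp] at hx
    exact absurd hx (lt_irrefl _)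
  have h1 := lintegral_rpow_eq_lintegral_meas_lt_mul ν (f := fun x => (S x).toReal)
    (Eventually.of_forall fun x => ENNReal.toReal_nonneg) hS.ennreal_toReal.aemeasurable hp
  have h2 : ∫⁻ x, ENNReal.ofReal ((S x).toReal ^ p) ∂ν = ∫⁻ x, S x ^ p ∂ν := by
    refine lintegral_congr_ae ?_
    filter_upwards [hae] with x hx
    rw [← ENNReal.ofReal_rpow_of_nonneg ENNReal.toReal_nonneg hp.le, ENNReal.ofReal_toReal hx]
  rw [h2, lintegral_Ioi_comp_mul_left_rpow hγ] at h1
  rw [h1, ← mul_assoc, mul_left_comm, ← mul_assoc, ← mul_assoc, ← ENNReal.ofReal_mul (by positivity),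
    Real.rpow_neg hγ.le, mul_inv_cancel₀ (by positivity), ENNReal.ofReal_one, one_mul]
  refine mul_le_mul' le_rfl ?_
  refine lintegral_mono_ae ?_
  filter_upwards [ae_restrict_mem measurableSet_Ioi] with t ht
  gcongr ?_ * _
  refine measure_mono_ae ?_
  filter_upwards [hae] with x hx hlt
  exact (ENNReal.ofReal_lt_iff_lt_toReal (mul_nonneg hγ.le (le_of_lt ht)) hx).1 hlt

end Integration

/-! ### Integration of the good-$\lambda$ inequality. -/

section GoodLambdaIntegration

variable {V : Type*} [NormedAddCommGroup V] [MeasurableSpace V] [NormedSpace ℝ V]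
  [FiniteDimensional ℝ V] [BorelSpace V]

/-- Otherwise `ν` would be finite, hence zero. A nonempty complement is needed for Whitney radii:
`Metric.infDist` to the empty set is $0$. -/
theorem densitySet_ne_univ [Nontrivial V] {μ ν : Measure V} [μ.IsAddHaarMeasure]
    (h : ComparableOnBalls μ ν) (hν : ν ≠ 0) {F : Set V} (hF : MeasurableSet F) (hFt : ν F ≠ ∞) :
    densitySet μ F ≠ Set.univ := by
  intro hU
  obtain ⟨C, hC⟩ := exists_measure_densitySet_le h
  refine hν (h.eq_zero_of_measure_univ_ne_top (ne_top_of_le_ne_top ?_ (hU ▸ hC F hF)))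
  exact ENNReal.mul_ne_top ENNReal.coe_ne_top hFt

/-- A Fefferman–Stein type inequality, in which mean oscillations are replaced by oscillations in
measure. -/
theorem exists_lintegral_rpow_le_of_oscillationBound [Nontrivial V] {μ ν : Measure V}
    [μ.IsAddHaarMeasure] (hν : ComparableOnBalls μ ν) (hac : ν ≪ μ) {p : ℝ} (hp : 0 < p)
    {Λ : ℝ≥0 → ℝ} (hΛ : ∀ ε, 0 < ε → 0 < Λ ε) :
    ∃ C : ℝ≥0, ∀ (g : V → ℝ) (S : V → ℝ≥0∞), Measurable g → (∀ x, 0 ≤ g x) →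
      LowerSemicontinuous S → (∀ ε, 0 < ε → OscillationBound μ g S ε (Λ ε)) →
      ∫⁻ x, ENNReal.ofReal (g x) ^ p ∂ν < ∞ →
      ∫⁻ x, ENNReal.ofReal (g x) ^ p ∂ν ≤ C * ∫⁻ x, S x ^ p ∂ν := by
  by_cases hν0 : ν = 0
  · exact ⟨0, fun g S _ _ _ _ _ => by simp [hν0]⟩
  obtain ⟨C₁, hC₁⟩ := exists_measure_densitySet_le (ComparableOnBalls.refl μ)
  obtain ⟨C₂, hC₂⟩ := exists_measure_densitySet_le hν
  obtain ⟨C₀, hC₀⟩ := hν.measure_biUnion_le (θ := 2⁻¹) (by positivity)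
  set C : ℝ≥0 := C₀ + 1 with hCdef
  have hC1 : (1 : ℝ) ≤ C := by rw [hCdef]; push_cast; linarith [C₀.coe_nonneg]
  obtain ⟨ε, hε0, hε4, hεC⟩ : ∃ ε : ℝ≥0, 0 < ε ∧ ε * (4 : ℝ≥0) ^ Module.finrank ℝ V < 2⁻¹ ∧
      C₁ * (ε * (3 : ℝ≥0) ^ Module.finrank ℝ V) ≤ 2⁻¹ := by
    set K : ℝ≥0 := (1 + C₁) * 4 ^ Module.finrank ℝ V with hK
    have hK1 : (4 : ℝ≥0) ^ Module.finrank ℝ V ≤ K := by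
      rw [hK]; exact le_mul_of_one_le_left zero_le (by simp)
    have hK2 : C₁ * (3 : ℝ≥0) ^ Module.finrank ℝ V ≤ K := by
      rw [hK]
      gcongr
      · simp
      · norm_num
    have hK0 : 0 < K := by positivity
    have h4 : (4⁻¹ : ℝ≥0) < 2⁻¹ := by rw [← NNReal.coe_lt_coe]; norm_num
    have hKK : 4⁻¹ * K⁻¹ * K = 4⁻¹ := by field_simp
    refine ⟨4⁻¹ * K⁻¹, by positivity, lt_of_le_of_lt ?_ h4, ?_⟩
    · calc 4⁻¹ * K⁻¹ * 4 ^ Module.finrank ℝ V ≤ 4⁻¹ * K⁻¹ * K := by gcongr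
        _ = _ := hKK
    · calc C₁ * (4⁻¹ * K⁻¹ * 3 ^ Module.finrank ℝ V)
          = 4⁻¹ * K⁻¹ * (C₁ * 3 ^ Module.finrank ℝ V) := by ring
        _ ≤ 4⁻¹ * K⁻¹ * K := by gcongr
        _ = 4⁻¹ := hKK
        _ ≤ _ := h4.le
  -- Chosen so that $CD^{-p}=C-1/2$: after scaling, $(CD^{-p}+1-C)I=I/2$ remains. The summand $1$ in
  -- `C` keeps $C-1/2$ positive, and `γ` is then the largest value with $1+2\Lambda\gamma\le D$.
  set D : ℝ := (C / (C - 1 / 2)) ^ (1 / p) with hD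
  have hCh : (0 : ℝ) < C - 1 / 2 := by linarith
  have hDp : D ^ p = C / (C - 1 / 2) := by
    rw [hD, ← Real.rpow_mul (by positivity), one_div_mul_cancel hp.ne', Real.rpow_one]
  have hD1 : 1 < D := Real.one_lt_rpow (by rw [lt_div_iff₀ hCh]; linarith) (by positivity)
  have hD0 : 0 < D := by linarith
  have hΛ0 := hΛ ε hε0
  set γ : ℝ := (D - 1) / (2 * Λ ε) with hγdef
  have hγ : 0 < γ := div_pos (by linarith) (by linarith)
  have hDγ : 1 + 2 * Λ ε * γ ≤ D := by
    rw [hγdef]; field_simp; linarith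
  refine ⟨2 * C * (γ ^ (-p)).toNNReal, fun g S hg hg0 hS hosc hfin => ?_⟩
  have hlay := lintegral_rpow_eq_lintegral_meas_lt_mul ν (Eventually.of_forall hg0) hg.aemeasurable hp
  have hgp : ∀ x, ENNReal.ofReal (g x) ^ p = ENNReal.ofReal (g x ^ p) := fun x =>
    ENNReal.ofReal_rpow_of_nonneg (hg0 x) hp.le
  simp only [hgp] at hfin ⊢
  have hgm : ∀ t : ℝ, MeasurableSet {x | t < g x} := fun t => measurableSet_lt measurable_const hg
  have hνt : ∀ t, 0 < t → ν {x | t < g x} ≠ ∞ := by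
    intro t ht htop
    have h1 := mul_meas_ge_le_lintegral (μ := ν) (hg.pow_const p).ennreal_ofReal
      (ENNReal.ofReal (t ^ p))
    have h2 : ν {x | t < g x} ≤ ν {x | ENNReal.ofReal (t ^ p) ≤ ENNReal.ofReal (g x ^ p)} :=
      measure_mono fun x (hx : t < g x) =>
        ENNReal.ofReal_le_ofReal (Real.rpow_le_rpow ht.le hx.le hp.le)
    rw [htop, top_le_iff] at h2
    rw [h2, ENNReal.mul_top (by simp; positivity)] at h1
    exact absurd (h1.trans_lt hfin) (lt_irrefl _)
  set Ω : ℝ → Set V := fun t => densitySet μ {x | t < g x} with hΩ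
  have hΩanti : Antitone fun t => ν (Ω t) := fun s t hst =>
    measure_mono (densitySet_mono μ fun x (hx : t < g x) => lt_of_le_of_lt hst hx)
  have hpow : Measurable fun t : ℝ => ENNReal.ofReal (t ^ (p - 1)) :=
    (measurable_id.pow_const _).ennreal_ofReal
  -- Written additively, since subtraction in `ℝ≥0∞` is truncated.
  have hgood : ∀ t, 0 < t → C * ν (Ω (D * t)) + ν (Ω t) ≤
      C * ν (Ω t) + C * ν {x | ENNReal.ofReal (γ * t) < S x} := by
    intro t ht
    set E := Ω (D * t) ∩ {x | S x ≤ ENNReal.ofReal (γ * t)} with hE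
    have hEm : MeasurableSet E := (isOpen_densitySet _ _).measurableSet.inter
      (measurableSet_le hS.measurable measurable_const)
    have hsub : Ω (D * t) ⊆ Ω t := densitySet_mono μ fun x (hx : D * t < g x) =>
      lt_of_le_of_lt (le_mul_of_one_le_left ht.le hD1.le) hx
    have h1 : ν (Ω t) ≤ C * ν (Ω t \ E) := by
      refine ((hosc ε hε0).measure_densitySet_le hg hS hC₁ hC₀ hε4 hεC hγ ht hDγ
        (densitySet_ne_univ hν hν0 (hgm t) (hνt t ht))).trans ?_
      gcongr
      rw [hCdef]; simp
    have h2 : ν (Ω (D * t)) ≤ ν E + ν {x | ENNReal.ofReal (γ * t) < S x} := by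
      refine (measure_mono fun x hx => ?_).trans (measure_union_le _ _)
      rcases le_or_gt (S x) (ENNReal.ofReal (γ * t)) with h | h
      · exact Or.inl ⟨hx, h⟩
      · exact Or.inr h
    have h3 : ν (Ω t) = ν E + ν (Ω t \ E) := by
      rw [← measure_inter_add_sdiff (Ω t) hEm,
        Set.inter_eq_right.2 (Set.inter_subset_left.trans hsub)]
    calc C * ν (Ω (D * t)) + ν (Ω t)
        ≤ C * (ν E + ν {x | ENNReal.ofReal (γ * t) < S x}) + C * ν (Ω t \ E) := by gcongr
      _ = C * (ν E + ν (Ω t \ E)) + C * ν {x | ENNReal.ofReal (γ * t) < S x} := by ring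
      _ = _ := by rw [← h3]
  set I := ∫⁻ t in Set.Ioi 0, ν (Ω t) * ENNReal.ofReal (t ^ (p - 1)) with hI
  set J := ∫⁻ t in Set.Ioi 0, ν {x | ENNReal.ofReal (γ * t) < S x} *
      ENNReal.ofReal (t ^ (p - 1)) with hJ
  have hpo : ENNReal.ofReal p ≠ 0 := by simpa using hp
  -- The only place where finiteness of the integral of $g^p$ is needed in full: `C * I` is
  -- cancelled from both sides later.
  have hIfin : I ≠ ∞ := by
    have h1 : I ≤ C₂ * ∫⁻ t in Set.Ioi 0, ν {x | t < g x} * ENNReal.ofReal (t ^ (p - 1)) := by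
      rw [← lintegral_const_mul' _ _ ENNReal.coe_ne_top]
      refine lintegral_mono fun t => ?_
      rw [← mul_assoc]
      gcongr
      exact hC₂ _ (hgm t)
    refine ne_top_of_le_ne_top (ENNReal.mul_ne_top ENNReal.coe_ne_top ?_) h1
    intro htop
    rw [htop, ENNReal.mul_top hpo] at hlay
    exact hfin.ne hlay
  have hgI : ∫⁻ x, ENNReal.ofReal (g x ^ p) ∂ν ≤ ENNReal.ofReal p * I := by
    rw [hlay]
    refine mul_le_mul' le_rfl ?_
    refine lintegral_mono fun t => ?_
    gcongr ?_ * _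
    refine measure_mono_ae ?_
    have := hac.ae_le (ae_imp_of_ae_restrict (ae_mem_densitySet μ {x | t < g x}))
    exact this
  have hscale : I = ENNReal.ofReal (D ^ p) *
      ∫⁻ t in Set.Ioi 0, ν (Ω (D * t)) * ENNReal.ofReal (t ^ (p - 1)) :=
    lintegral_Ioi_comp_mul_left_rpow hD0 _
  set I' := ∫⁻ t in Set.Ioi 0, ν (Ω (D * t)) * ENNReal.ofReal (t ^ (p - 1)) with hI'
  have hmain : C * I' + I ≤ C * I + C * J := by
    have hm1 : Measurable fun t => ν (Ω t) * ENNReal.ofReal (t ^ (p - 1)) :=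
      hΩanti.measurable.mul hpow
    rw [hI', hI, hJ, ← lintegral_const_mul' _ _ ENNReal.coe_ne_top,
      ← lintegral_const_mul' _ _ ENNReal.coe_ne_top,
      ← lintegral_const_mul' _ _ ENNReal.coe_ne_top, ← lintegral_add_right _ hm1,
      ← lintegral_add_left (hm1.const_mul _)]
    refine lintegral_mono_ae ?_
    filter_upwards [ae_restrict_mem measurableSet_Ioi] with t ht
    calc C * (ν (Ω (D * t)) * ENNReal.ofReal (t ^ (p - 1))) + ν (Ω t) * ENNReal.ofReal (t ^ (p - 1))
        = (C * ν (Ω (D * t)) + ν (Ω t)) * ENNReal.ofReal (t ^ (p - 1)) := by ring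
      _ ≤ (C * ν (Ω t) + C * ν {x | ENNReal.ofReal (γ * t) < S x}) * ENNReal.ofReal (t ^ (p - 1)) := by
        gcongr ?_ * _
        exact hgood t ht
      _ = _ := by ring
  have hCI' : C * I' = ENNReal.ofReal (C - 1 / 2) * I := by
    rw [hscale, ← mul_assoc, ← ENNReal.ofReal_mul hCh.le, hDp, mul_div_cancel₀ _ hCh.ne',
      ENNReal.ofReal_coe_nnreal]
  have hIJ : I ≤ 2 * C * J := by
    have h1 : C * I + ENNReal.ofReal (1 / 2) * I ≤ C * I + C * J := by
      refine le_trans (le_of_eq ?_) hmain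
      rw [hCI', ← add_mul]
      conv_rhs => rw [← one_mul I, ← mul_assoc, mul_one, ← add_mul, ← ENNReal.ofReal_one,
        ← ENNReal.ofReal_add hCh.le zero_le_one]
      congr 1
      rw [← ENNReal.ofReal_coe_nnreal, ← ENNReal.ofReal_add (by positivity) (by norm_num)]
      congr 1
      ring
    have h2 := (ENNReal.add_le_add_iff_left
      (ENNReal.mul_ne_top ENNReal.coe_ne_top hIfin)).1 h1
    calc I = 2 * (ENNReal.ofReal (1 / 2) * I) := by
          rw [← mul_assoc, ← ENNReal.ofReal_ofNat, ← ENNReal.ofReal_mul (by norm_num)]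
          norm_num
      _ ≤ 2 * (C * J) := by gcongr
      _ = _ := by ring
  calc ∫⁻ x, ENNReal.ofReal (g x ^ p) ∂ν ≤ ENNReal.ofReal p * I := hgI
    _ ≤ ENNReal.ofReal p * (2 * C * J) := by gcongr
    _ = 2 * C * (ENNReal.ofReal p * J) := by ring
    _ ≤ 2 * C * (ENNReal.ofReal (γ ^ (-p)) * ∫⁻ x, S x ^ p ∂ν) := by
        gcongr 2 * C * ?_
        exact lintegral_Ioi_measure_lt_mul_rpow_le ν hS.measurable hp hγ
    _ = _ := by
        rw [← mul_assoc]
        rfl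

end GoodLambdaIntegration

/-! ### Banach sequence spaces. -/

section SequenceSpace

variable {X : Type*} [NormedAddCommGroup X] [NormedSpace ℝ X] [BanachSequenceSpace X]

namespace BanachSequenceSpace

theorem norm_le_of_abs_coord_le {u v : X} (h : ∀ l, |coord u l| ≤ |coord v l|) : ‖u‖ ≤ ‖v‖ := by
  obtain ⟨u', hu', hle⟩ := monotone_norm v (coord u) h
  rwa [coord_injective hu'] at hle

/-- If the coordinate is not identically zero, the unit sequence $e$ lies in $X$ by monotonicity,
and $|v_l|\,e$ is dominated by $v$. Continuity lets coordinates commute with Bochner integrals. -/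
theorem exists_abs_coord_le (X : Type*) [NormedAddCommGroup X] [NormedSpace ℝ X]
    [BanachSequenceSpace X] (l : ℤ) : ∃ C : ℝ, ∀ v : X, |coord v l| ≤ C * ‖v‖ := by
  by_cases h : ∃ v₀ : X, coord v₀ l ≠ 0
  · obtain ⟨v₀, hv₀⟩ := h
    obtain ⟨e, he, -⟩ := monotone_norm ((coord v₀ l)⁻¹ • v₀) (Pi.single l 1) (by
      intro m
      by_cases hm : m = l
      · subst hm; simp [hv₀]
      · simp only [Pi.single_eq_of_ne hm, abs_zero]
        exact abs_nonneg _)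
    have he0 : e ≠ 0 := by
      rintro rfl
      have := congrFun he l
      simp at this
    have hen : 0 < ‖e‖ := norm_pos_iff.2 he0
    refine ⟨‖e‖⁻¹, fun v => ?_⟩
    have := norm_le_of_abs_coord_le (u := coord v l • e) (v := v) (by
      intro m
      rw [map_smul, he, Pi.smul_apply]
      by_cases hm : m = l
      · subst hm; simp
      · simp [Pi.single_eq_of_ne hm])
    rw [norm_smul, Real.norm_eq_abs] at this
    rw [inv_mul_eq_div, le_div_iff₀ hen]
    exact this
  · push Not at h
    exact ⟨0, fun v => by simp [h v]⟩

/-- The coordinate functionals are continuous. -/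
noncomputable def coordCLM (X : Type*) [NormedAddCommGroup X] [NormedSpace ℝ X]
    [BanachSequenceSpace X] (l : ℤ) : X →L[ℝ] ℝ :=
  LinearMap.mkContinuousOfExistsBound ((LinearMap.proj l).comp coord) (exists_abs_coord_le X l)

@[simp]
theorem coordCLM_apply (l : ℤ) (v : X) : coordCLM X l v = coord v l := rfl

end BanachSequenceSpace

open BanachSequenceSpace

theorem seqNorm_coord (v : X) : seqNorm X (coord v) = ‖v‖ₑ := by
  refine le_antisymm (iInf₂_le (f := fun (u : X) (_ : coord u = coord v) => ‖u‖ₑ) v rfl) (le_iInf₂ fun u hu => ?_)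
  rw [coord_injective hu]

theorem exists_coord_eq_of_seqNorm_le {a : ℤ → ℝ} {C : ℝ≥0} (h : seqNorm X a ≤ C) :
    ∃ v : X, coord v = a ∧ ‖v‖ ≤ C := by
  by_cases hv : ∃ v : X, coord v = a
  · obtain ⟨v, rfl⟩ := hv
    refine ⟨v, rfl, ?_⟩
    rw [seqNorm_coord] at h
    exact enorm_le_coe.1 h
  · have : seqNorm X a = ⊤ := by
      simp only [seqNorm, iInf_eq_top]
      exact fun v hva => absurd ⟨v, hva⟩ hv
    rw [this] at h
    exact absurd h (by simp)

end SequenceSpace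

/-! ### Bounded functions with compact support. -/

section BoundedCompactSupport

variable {n : ℕ} {f g : EuclideanSpace ℝ (Fin n) → ℝ}

theorem MemLInftyC.add (hf : MemLInftyC f) (hg : MemLInftyC g) : MemLInftyC (f + g) :=
  ⟨hf.1.add hg.1, hf.2.add hg.2⟩

theorem MemLInftyC.neg (hf : MemLInftyC f) : MemLInftyC (-f) :=
  ⟨hf.1.neg, hf.2.neg⟩

theorem MemLInftyC.sub (hf : MemLInftyC f) (hg : MemLInftyC g) : MemLInftyC (f - g) := by
  rw [sub_eq_add_neg]; exact hf.add hg.neg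

theorem MemLInftyC.indicator (hf : MemLInftyC f) {s : Set (EuclideanSpace ℝ (Fin n))}
    (hs : MeasurableSet s) : MemLInftyC (s.indicator f) :=
  ⟨hf.1.indicator hs, hf.2.mono (by
    intro x hx h
    exact hx (by simp [h]))⟩

theorem MemLInftyC.zero : MemLInftyC (0 : EuclideanSpace ℝ (Fin n) → ℝ) :=
  ⟨MemLp.zero, HasCompactSupport.zero⟩

theorem memLInftyC_indicator_ball_const (c : EuclideanSpace ℝ (Fin n)) (r a : ℝ) :
    MemLInftyC ((Metric.ball c r).indicator fun _ => a) :=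
  ⟨(memLp_top_const a).indicator measurableSet_ball,
    HasCompactSupport.intro (isCompact_closedBall c r) fun _ hx =>
      Set.indicator_of_notMem (fun h => hx (Metric.ball_subset_closedBall h)) _⟩

theorem MemLInftyC.sum {ι : Type*} (s : Finset ι) {f : ι → EuclideanSpace ℝ (Fin n) → ℝ}
    (hf : ∀ i ∈ s, MemLInftyC (f i)) : MemLInftyC (∑ i ∈ s, f i) := by
  classical
  induction s using Finset.induction_on with
  | empty => simpa using MemLInftyC.zero
  | insert a s ha ih =>
    rw [Finset.sum_insert ha]
    exact (hf a (by simp)).add (ih fun i hi => hf i (by simp [hi]))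

theorem MemLInftyC.integrable (hf : MemLInftyC f) : Integrable f :=
  (integrableOn_iff_integrable_of_support_subset (subset_tsupport f)).1
    ((hf.1.locallyIntegrable le_top).integrableOn_isCompact hf.2)

end BoundedCompactSupport

/-! ### Principal values and strongly measurable representatives. -/

section SingularIntegral

open BanachSequenceSpace

variable {n : ℕ} {X : Type*} [NormedAddCommGroup X] [NormedSpace ℝ X] [BanachSequenceSpace X]
  {K : EuclideanSpace ℝ (Fin n) → X} {f g : EuclideanSpace ℝ (Fin n) → ℝ} {l : ℤ}

/-- On the compact set of points of the support at distance at least `δ` from `x`, the argument of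
the kernel avoids the singularity, and `f` is bounded. -/
theorem integrableOn_kernelCoord_mul (hK : LocallyIntegrableOn (kernelCoord K l) {0}ᶜ volume)
    (hf : MemLInftyC f) (x : EuclideanSpace ℝ (Fin n)) {δ : ℝ} (hδ : 0 < δ) :
    IntegrableOn (fun y => kernelCoord K l (x - y) * f y) {y | δ ≤ ‖x - y‖} := by
  set k := {y | δ ≤ ‖x - y‖} ∩ tsupport f with hk
  have hcl : IsClosed {y : EuclideanSpace ℝ (Fin n) | δ ≤ ‖x - y‖} :=
    isClosed_le continuous_const (by fun_prop)
  have hkc : IsCompact k := hf.2.inter_left hcl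
  have hk' : IsCompact ((fun y => x - y) '' k) := hkc.image (by fun_prop)
  have h0 : (fun y => x - y) '' k ⊆ {0}ᶜ := by
    rintro _ ⟨y, hy, rfl⟩ h
    have h1 : δ ≤ ‖x - y‖ := hy.1
    simp only [Set.mem_singleton_iff] at h
    rw [h, norm_zero] at h1
    linarith
  have h1 := hK.integrableOn_compact_subset h0 hk'
  have hpre : (fun y => x - y) ⁻¹' ((fun y => x - y) '' k) = k :=
    Set.preimage_image_eq _ sub_right_injective
  have h2 : IntegrableOn (fun y => kernelCoord K l (x - y)) k := by
    rw [← hpre]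
    exact ((Measure.measurePreserving_sub_left volume x).integrableOn_comp_preimage
      (Homeomorph.subLeft x).measurableEmbedding).2 h1
  have h3 : IntegrableOn (fun y => kernelCoord K l (x - y) * f y) k := by
    exact Integrable.smul_of_top_left h2 (hf.1.restrict k)
  refine h3.of_forall_sdiff_eq_zero hcl.measurableSet fun y hy => ?_
  have : y ∉ tsupport f := fun h => hy.2 ⟨hy.1, h⟩
  rw [image_eq_zero_of_notMem_tsupport this, mul_zero]

theorem integrable_kernelCoord_mul (hK : LocallyIntegrableOn (kernelCoord K l) {0}ᶜ volume)
    (hf : MemLInftyC f) {x : EuclideanSpace ℝ (Fin n)} {δ : ℝ} (hδ : 0 < δ)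
    (hfx : ∀ y, ‖x - y‖ < δ → f y = 0) : Integrable fun y => kernelCoord K l (x - y) * f y := by
  rw [← integrableOn_univ]
  refine (integrableOn_kernelCoord_mul hK hf x hδ).of_forall_sdiff_eq_zero MeasurableSet.univ
    fun y hy => ?_
  rw [hfx y (not_le.1 fun h => hy.2 h), mul_zero]

/-- The truncations are constant for $\varepsilon<\delta$, so the principal value exists at this
very point and not only almost everywhere. -/
theorem singularIntegral_eq_integral {x : EuclideanSpace ℝ (Fin n)} {δ : ℝ} (hδ : 0 < δ)
    (hfx : ∀ y, ‖x - y‖ < δ → f y = 0) :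
    singularIntegral K f x l = ∫ y, kernelCoord K l (x - y) * f y := by
  refine Tendsto.limUnder_eq (tendsto_const_nhds.congr' ?_)
  filter_upwards [Ioo_mem_nhdsGT hδ] with ε hε
  refine (setIntegral_eq_integral_of_forall_compl_eq_zero fun y hy => ?_).symm
  have hy' : ‖x - y‖ ≤ ε := not_lt.1 hy
  rw [hfx y (hy'.trans_lt hε.2), mul_zero]

theorem truncInt_add (hK : LocallyIntegrableOn (kernelCoord K l) {0}ᶜ volume)
    (hf : MemLInftyC f) (hg : MemLInftyC g) (x : EuclideanSpace ℝ (Fin n)) {ε : ℝ} (hε : 0 < ε) :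
    truncInt K (f + g) l x ε = truncInt K f l x ε + truncInt K g l x ε := by
  have hsub : {y : EuclideanSpace ℝ (Fin n) | ε < ‖x - y‖} ⊆ {y | ε ≤ ‖x - y‖} :=
    fun y (hy : ε < ‖x - y‖) => hy.le
  rw [truncInt, truncInt, truncInt,
    ← integral_add ((integrableOn_kernelCoord_mul hK hf x hε).mono_set hsub)
      ((integrableOn_kernelCoord_mul hK hg x hε).mono_set hsub)]
  simp [mul_add]

theorem IsSingularIntegralOperator.ae_singularIntegral_add (hT : IsSingularIntegralOperator K)
    (hf : MemLInftyC f) (hg : MemLInftyC g) : ∀ᵐ x,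
      singularIntegral K (f + g) x = singularIntegral K f x + singularIntegral K g x := by
  have h1 := ae_all_iff.2 (hT.principalValue f hf)
  have h2 := ae_all_iff.2 (hT.principalValue g hg)
  filter_upwards [h1, h2] with x hx1 hx2
  funext l
  obtain ⟨a, ha⟩ := hx1 l
  obtain ⟨b, hb⟩ := hx2 l
  have hab : Tendsto (truncInt K (f + g) l x) (𝓝[>] 0) (𝓝 (a + b)) := by
    refine (ha.add hb).congr' ?_
    filter_upwards [self_mem_nhdsWithin] with ε hε
    exact (truncInt_add (hT.locallyIntegrable l) hf hg x hε).symm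
  rw [Pi.add_apply, singularIntegral, hab.limUnder_eq, singularIntegral, ha.limUnder_eq,
    singularIntegral, hb.limUnder_eq]

/-- `F` is a strongly measurable `X`-valued function representing `Tf`. -/
def RepresentsSingularIntegral (K : EuclideanSpace ℝ (Fin n) → X)
    (f : EuclideanSpace ℝ (Fin n) → ℝ) (F : EuclideanSpace ℝ (Fin n) → X) : Prop :=
  AEStronglyMeasurable F volume ∧ ∀ᵐ x, coord (F x) = singularIntegral K f x

variable {F F₁ F₂ : EuclideanSpace ℝ (Fin n) → X}

theorem RepresentsSingularIntegral.ae_eq (h₁ : RepresentsSingularIntegral K f F₁)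
    (h₂ : RepresentsSingularIntegral K f F₂) : F₁ =ᵐ[volume] F₂ := by
  filter_upwards [h₁.2, h₂.2] with x hx1 hx2
  exact coord_injective (hx1.trans hx2.symm)

theorem RepresentsSingularIntegral.add (hT : IsSingularIntegralOperator K)
    (hf : MemLInftyC f) (hg : MemLInftyC g) (h₁ : RepresentsSingularIntegral K f F₁)
    (h₂ : RepresentsSingularIntegral K g F₂) :
    RepresentsSingularIntegral K (f + g) (F₁ + F₂) := by
  refine ⟨h₁.1.add h₂.1, ?_⟩
  filter_upwards [h₁.2, h₂.2, hT.ae_singularIntegral_add hf hg] with x hx1 hx2 hx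
  rw [Pi.add_apply, map_add, hx1, hx2, hx]

theorem RepresentsSingularIntegral.zero : RepresentsSingularIntegral K 0 0 := by
  refine ⟨aestronglyMeasurable_zero, Eventually.of_forall fun x => ?_⟩
  funext l
  rw [singularIntegral_eq_integral (f := 0) one_pos fun _ _ => rfl]
  simp

theorem RepresentsSingularIntegral.sum (hT : IsSingularIntegralOperator K) {ι : Type*}
    (s : Finset ι) {f : ι → EuclideanSpace ℝ (Fin n) → ℝ} {F : ι → EuclideanSpace ℝ (Fin n) → X}
    (hf : ∀ i ∈ s, MemLInftyC (f i)) (hF : ∀ i ∈ s, RepresentsSingularIntegral K (f i) (F i)) :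
    RepresentsSingularIntegral K (∑ i ∈ s, f i) (∑ i ∈ s, F i) := by
  classical
  induction s using Finset.induction_on with
  | empty => simpa using RepresentsSingularIntegral.zero
  | insert a s ha ih =>
    rw [Finset.sum_insert ha, Finset.sum_insert ha]
    have hs : ∀ i ∈ s, MemLInftyC (f i) := fun i hi => hf i (by simp [hi])
    exact RepresentsSingularIntegral.add hT (hf a (by simp)) (MemLInftyC.sum s hs)
      (hF a (by simp)) (ih hs fun i hi => hF i (by simp [hi]))

theorem IsSingularIntegralOperator.exists_represents (hT : IsSingularIntegralOperator K)
    (hf : MemLInftyC f) : ∃ F, RepresentsSingularIntegral K f F := by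
  obtain ⟨p₀, -, C, hC⟩ := hT.strongType
  obtain ⟨F, hF, hF', -⟩ := hC f hf
  exact ⟨F, hF, hF'⟩

theorem IsSingularIntegralOperator.exists_lintegral_rpow_le (hT : IsSingularIntegralOperator K) :
    ∃ p₀ : ℝ, 1 < p₀ ∧ ∃ C : ℝ≥0, ∀ (f : EuclideanSpace ℝ (Fin n) → ℝ)
      (F : EuclideanSpace ℝ (Fin n) → X), MemLInftyC f → RepresentsSingularIntegral K f F →
      ∫⁻ x, ‖F x‖ₑ ^ p₀ ≤ C * ∫⁻ x, ‖f x‖ₑ ^ p₀ := by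
  obtain ⟨p₀, hp₀, C, hC⟩ := hT.strongType
  have hp0 : 0 < p₀ := by linarith
  refine ⟨p₀, hp₀, C ^ p₀, fun f F hf hF => ?_⟩
  obtain ⟨F', hF', hF'2, hle⟩ := hC f hf
  have hae : F =ᵐ[volume] F' := hF.ae_eq ⟨hF', hF'2⟩
  rw [← eLpNorm_congr_ae hae, eLpNorm_eq_lintegral_rpow_enorm_toReal (by simpa using hp0)
    ENNReal.ofReal_ne_top, eLpNorm_eq_lintegral_rpow_enorm_toReal (by simpa using hp0)
    ENNReal.ofReal_ne_top, ENNReal.toReal_ofReal hp0.le] at hle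
  have := ENNReal.rpow_le_rpow hle hp0.le
  rwa [ENNReal.mul_rpow_of_nonneg _ _ hp0.le, ← ENNReal.rpow_mul, ← ENNReal.rpow_mul,
    one_div_mul_cancel hp0.ne', ENNReal.rpow_one, ENNReal.rpow_one,
    ← ENNReal.coe_rpow_of_nonneg _ hp0.le] at this

end SingularIntegral

/-! ### Luxemburg averages, Young's and Hölder's inequalities. -/

section Luxemburg

variable {n : ℕ} {G : Type*} [NormedAddCommGroup G]

/-- Young's inequality, immediate from the supremum because truncated subtraction is adjoint to
addition. -/
theorem mul_le_add_complementary (A : ℝ≥0 → ℝ≥0) (s t : ℝ≥0) :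
    (s * t : ℝ≥0∞) ≤ A s + complementary A t := by
  rw [← tsub_le_iff_left]
  refine le_trans (le_of_eq ?_)
    (le_iSup (fun s : ℝ≥0 => ((t * s : ℝ≥0) : ℝ≥0∞) - (A s : ℝ≥0∞)) s)
  rw [mul_comm, ENNReal.coe_mul]

/-- Attainment of the infimum is never needed: estimates are made with a slightly larger admissible
`lam`. -/
theorem exists_lt_of_luxNorm_lt {Φ : ℝ≥0 → ℝ≥0∞} {f : EuclideanSpace ℝ (Fin n) → G}
    {c : EuclideanSpace ℝ (Fin n)} {r : ℝ} (hr : 0 < r) {a : ℝ≥0∞}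
    (h : luxNorm Φ f (Metric.ball c r) < a) : ∃ lam : ℝ≥0, 0 < lam ∧ (lam : ℝ≥0∞) < a ∧
      ∫⁻ x in Metric.ball c r, Φ (‖f x‖₊ / lam) ≤ volume (Metric.ball c r) := by
  simp only [luxNorm, iInf_lt_iff] at h
  obtain ⟨lam, ⟨h0, h1⟩, h2⟩ := h
  refine ⟨lam, h0, h2, ?_⟩
  rwa [ENNReal.inv_mul_le_iff (Metric.measure_ball_pos volume c hr).ne' measure_ball_lt_top.ne,
    mul_one] at h1

theorem enorm_eq_mul_div (a : G) {lam : ℝ≥0} (h : 0 < lam) :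
    ‖a‖ₑ = lam * ((‖a‖₊ / lam : ℝ≥0) : ℝ≥0∞) := by
  rw [← ENNReal.coe_mul, mul_div_cancel₀ _ h.ne', enorm_eq_nnnorm]

theorem lintegral_enorm_le_luxNorm_id {f : EuclideanSpace ℝ (Fin n) → G}
    {c : EuclideanSpace ℝ (Fin n)} {r : ℝ} (hr : 0 < r) :
    ∫⁻ x in Metric.ball c r, ‖f x‖ₑ ≤ volume (Metric.ball c r) *
      luxNorm (fun t => (t : ℝ≥0∞)) f (Metric.ball c r) := by
  rw [← ENNReal.inv_mul_le_iff (Metric.measure_ball_pos volume c hr).ne' measure_ball_lt_top.ne]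
  refine le_of_forall_gt_imp_ge_of_dense fun a ha => ?_
  obtain ⟨lam, h0, hlt, hle⟩ := exists_lt_of_luxNorm_lt hr ha
  refine le_trans ?_ hlt.le
  rw [ENNReal.inv_mul_le_iff (Metric.measure_ball_pos volume c hr).ne' measure_ball_lt_top.ne]
  simp only [enorm_eq_mul_div _ h0]
  rw [lintegral_const_mul' _ _ ENNReal.coe_ne_top, mul_comm]
  gcongr

/-- Young's inequality at $s=1$: $t\le\mathcal A(1)+\overline{\mathcal A}(t)$. -/
theorem lintegral_enorm_le_luxNorm_complementary (A : ℝ≥0 → ℝ≥0)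
    {f : EuclideanSpace ℝ (Fin n) → G} {c : EuclideanSpace ℝ (Fin n)} {r : ℝ} (hr : 0 < r) :
    ∫⁻ x in Metric.ball c r, ‖f x‖ₑ ≤ (A 1 + 1) * volume (Metric.ball c r) *
      luxNorm (complementary A) f (Metric.ball c r) := by
  have hv0 := (Metric.measure_ball_pos volume c hr).ne'
  have hvt : volume (Metric.ball c r) ≠ ∞ := measure_ball_lt_top.ne
  have hA0 : ((A 1 : ℝ≥0∞) + 1) * volume (Metric.ball c r) ≠ 0 := mul_ne_zero (by simp) hv0
  have hAt : ((A 1 : ℝ≥0∞) + 1) * volume (Metric.ball c r) ≠ ∞ := ENNReal.mul_ne_top (by simp) hvt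
  rw [← ENNReal.inv_mul_le_iff hA0 hAt]
  refine le_of_forall_gt_imp_ge_of_dense fun a ha => ?_
  obtain ⟨lam, h0, hlt, hle⟩ := exists_lt_of_luxNorm_lt hr ha
  refine le_trans ?_ hlt.le
  rw [ENNReal.inv_mul_le_iff hA0 hAt]
  simp only [enorm_eq_mul_div _ h0]
  rw [lintegral_const_mul' _ _ ENNReal.coe_ne_top, mul_comm]
  gcongr
  calc ∫⁻ x in Metric.ball c r, ((‖f x‖₊ / lam : ℝ≥0) : ℝ≥0∞)
      ≤ ∫⁻ x in Metric.ball c r, (A 1 + complementary A (‖f x‖₊ / lam)) := by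
        refine lintegral_mono fun x => ?_
        simpa using mul_le_add_complementary A 1 (‖f x‖₊ / lam)
    _ = A 1 * volume (Metric.ball c r) +
          ∫⁻ x in Metric.ball c r, complementary A (‖f x‖₊ / lam) := by
        rw [lintegral_add_left measurable_const, setLIntegral_const]
    _ ≤ A 1 * volume (Metric.ball c r) + volume (Metric.ball c r) := by gcongr
    _ = _ := by ring

/-- The generalized Hölder inequality. -/
theorem lintegral_enorm_mul_le_luxNorm {A : ℝ≥0 → ℝ≥0} (hA : Continuous A)
    {f : EuclideanSpace ℝ (Fin n) → G} {g : EuclideanSpace ℝ (Fin n) → ℝ}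
    (hf : AEStronglyMeasurable f) {c : EuclideanSpace ℝ (Fin n)} {r : ℝ} (hr : 0 < r)
    (hft : luxNorm (fun t => (A t : ℝ≥0∞)) f (Metric.ball c r) ≠ ∞)
    (hgt : luxNorm (complementary A) g (Metric.ball c r) ≠ ∞) :
    ∫⁻ x in Metric.ball c r, ‖f x‖ₑ * ‖g x‖ₑ ≤ 2 * volume (Metric.ball c r) *
      (luxNorm (fun t => (A t : ℝ≥0∞)) f (Metric.ball c r) *
        luxNorm (complementary A) g (Metric.ball c r)) := by
  have hv0 := (Metric.measure_ball_pos volume c hr).ne'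
  have hvt : volume (Metric.ball c r) ≠ ∞ := measure_ball_lt_top.ne
  have h20 : 2 * volume (Metric.ball c r) ≠ 0 := mul_ne_zero (by simp) hv0
  have h2t : 2 * volume (Metric.ball c r) ≠ ∞ := ENNReal.mul_ne_top (by simp) hvt
  rw [← ENNReal.inv_mul_le_iff h20 h2t]
  refine ENNReal.le_mul_of_forall_lt (Or.inr hgt) (Or.inl hft) fun a ha b hb => ?_
  obtain ⟨lam, hl0, hllt, hlle⟩ := exists_lt_of_luxNorm_lt hr ha
  obtain ⟨mu, hm0, hmlt, hmle⟩ := exists_lt_of_luxNorm_lt hr hb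
  refine le_trans ?_ (mul_le_mul' hllt.le hmlt.le)
  rw [ENNReal.inv_mul_le_iff h20 h2t]
  -- Measurability of one summand suffices to split the integral, so nothing is asked of the
  -- complementary term.
  have hAm : AEMeasurable (fun x => (A (‖f x‖₊ / lam) : ℝ≥0∞))
      (volume.restrict (Metric.ball c r)) :=
    (hA.measurable.comp_aemeasurable (hf.nnnorm.aemeasurable.div_const lam)).coe_nnreal_ennreal.restrict
  calc ∫⁻ x in Metric.ball c r, ‖f x‖ₑ * ‖g x‖ₑ
      = ∫⁻ x in Metric.ball c r, (lam * mu : ℝ≥0∞) *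
          (((‖f x‖₊ / lam : ℝ≥0) : ℝ≥0∞) * ((‖g x‖₊ / mu : ℝ≥0) : ℝ≥0∞)) := by
        refine lintegral_congr fun x => ?_
        rw [enorm_eq_mul_div (f x) hl0, enorm_eq_mul_div (g x) hm0]
        ring
    _ = (lam * mu : ℝ≥0∞) * ∫⁻ x in Metric.ball c r,
          (((‖f x‖₊ / lam : ℝ≥0) : ℝ≥0∞) * ((‖g x‖₊ / mu : ℝ≥0) : ℝ≥0∞)) :=
        lintegral_const_mul' _ _ (ENNReal.mul_ne_top ENNReal.coe_ne_top ENNReal.coe_ne_top)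
    _ ≤ (lam * mu : ℝ≥0∞) * ∫⁻ x in Metric.ball c r,
          ((A (‖f x‖₊ / lam) : ℝ≥0∞) + complementary A (‖g x‖₊ / mu)) := by
        gcongr with x
        exact mul_le_add_complementary A _ _
    _ ≤ (lam * mu : ℝ≥0∞) * (volume (Metric.ball c r) + volume (Metric.ball c r)) := by
        rw [lintegral_add_left' hAm]
        gcongr
    _ = _ := by ring

theorem luxNorm_comp_sub_left (Φ : ℝ≥0 → ℝ≥0∞) (f : EuclideanSpace ℝ (Fin n) → G)
    (c : EuclideanSpace ℝ (Fin n)) (r : ℝ) :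
    luxNorm Φ (fun u => f (c - u)) (Metric.ball 0 r) = luxNorm Φ f (Metric.ball c r) := by
  have hpre : (fun u => c - u) ⁻¹' Metric.ball c r = Metric.ball 0 r := by
    ext u; simp [dist_eq_norm]
  have h1 : ∀ lam : ℝ≥0, ∫⁻ u in Metric.ball 0 r, Φ (‖f (c - u)‖₊ / lam) =
      ∫⁻ u in Metric.ball c r, Φ (‖f u‖₊ / lam) := by
    intro lam
    rw [← hpre]
    exact (Measure.measurePreserving_sub_left volume c).setLIntegral_comp_preimage_emb
      (Homeomorph.subLeft c).measurableEmbedding (fun u => Φ (‖f u‖₊ / lam)) _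
  simp only [luxNorm, h1, Measure.addHaar_ball_center]

theorem lowerSemicontinuous_luxMaximal (Φ : ℝ≥0 → ℝ≥0∞) (f : EuclideanSpace ℝ (Fin n) → ℝ) :
    LowerSemicontinuous (luxMaximal Φ f) := by
  intro x a ha
  simp only [luxMaximal, lt_iSup_iff] at ha
  obtain ⟨c, r, ⟨hr, hx⟩, hlt⟩ := ha
  filter_upwards [Metric.isOpen_ball.mem_nhds hx] with y hy
  exact hlt.trans_le (le_iSup₂_of_le c r (le_iSup_of_le ⟨hr, hy⟩ le_rfl))

theorem luxNorm_le_luxMaximal (Φ : ℝ≥0 → ℝ≥0∞) (f : EuclideanSpace ℝ (Fin n) → ℝ)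
    {c x : EuclideanSpace ℝ (Fin n)} {r : ℝ} (hx : x ∈ Metric.ball c r) :
    luxNorm Φ f (Metric.ball c r) ≤ luxMaximal Φ f x :=
  le_iSup₂_of_le c r (le_iSup_of_le ⟨Metric.pos_of_mem_ball hx, hx⟩ le_rfl)

end Luxemburg

/-! ### Dyadic annuli. -/

section Annuli

variable {n : ℕ}

/-- The annulus `s < |y| ≤ 2 s`. -/
def annulus (n : ℕ) (s : ℝ) : Set (EuclideanSpace ℝ (Fin n)) := {y | s < ‖y‖ ∧ ‖y‖ ≤ 2 * s}

/-- The annulus contains its outer sphere while the averaging ball is open; the sphere is null. -/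
theorem setLIntegral_annulus_le (s : ℝ) (hs : 0 < s) (ψ : EuclideanSpace ℝ (Fin n) → ℝ≥0∞) :
    ∫⁻ u in annulus n s, ψ u ≤ ∫⁻ u in Metric.ball 0 (2 * s), (annulus n s).indicator ψ u := by
  have hm : MeasurableSet (annulus n s) :=
    (measurableSet_lt measurable_const measurable_norm).inter
      (measurableSet_le measurable_norm measurable_const)
  rw [← lintegral_indicator hm, ← lintegral_indicator measurableSet_ball]
  refine lintegral_mono_ae ?_
  have hae : ∀ᵐ y ∂(volume : Measure (EuclideanSpace ℝ (Fin n))), y ∉ Metric.sphere 0 (2 * s) :=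
    measure_eq_zero_iff_ae_notMem.1 (Measure.addHaar_sphere_of_ne_zero _ _ (by positivity))
  filter_upwards [hae] with y hy
  by_cases hys : y ∈ annulus n s
  · have hyb : y ∈ Metric.ball (0 : EuclideanSpace ℝ (Fin n)) (2 * s) := by
      rw [mem_ball_zero_iff]
      refine lt_of_le_of_ne hys.2 fun h => hy ?_
      rw [mem_sphere_zero_iff_norm, h]
    rw [Set.indicator_of_mem hyb]
  · rw [Set.indicator_of_notMem hys]
    exact zero_le

theorem setLIntegral_two_mul_lt_norm_le {R : ℝ} (hR : 0 < R)
    (ψ : EuclideanSpace ℝ (Fin n) → ℝ≥0∞) :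
    ∫⁻ u in {u | 2 * R < ‖u‖}, ψ u ≤ ∑' m : ℕ, ∫⁻ u in Metric.ball 0 (2 * (2 ^ (m + 1) * R)),
      (annulus n (2 ^ (m + 1) * R)).indicator ψ u := by
  have hsub : {u : EuclideanSpace ℝ (Fin n) | 2 * R < ‖u‖} ⊆
      ⋃ m : ℕ, annulus n (2 ^ (m + 1) * R) := by
    intro u hu
    have hu' : 2 * R < ‖u‖ := hu
    obtain ⟨N, hN⟩ := pow_unbounded_of_one_lt (‖u‖ / R) (one_lt_two (α := ℝ))
    rw [div_lt_iff₀ hR] at hN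
    classical
    have hex : ∃ m : ℕ, ‖u‖ ≤ 2 ^ m * R := ⟨N, hN.le⟩
    set k := Nat.find hex with hk
    have hk1 : ‖u‖ ≤ 2 ^ k * R := Nat.find_spec hex
    -- The first annulus in the sums is $2R<|u|\le4R$, so the least $k$ with $|u|\le2^kR$
    -- corresponds to the index $m=k-2$.
    have hk2 : 2 ≤ k := by
      by_contra! h
      have : (2 : ℝ) ^ k ≤ 2 ^ 1 := pow_le_pow_right₀ (by norm_num) (by omega)
      nlinarith
    obtain ⟨m, hm⟩ := Nat.exists_eq_add_of_le hk2
    refine Set.mem_iUnion.2 ⟨m, ?_, ?_⟩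
    · exact not_le.1 (Nat.find_min hex (m := m + 1) (by omega))
    · refine hk1.trans (le_of_eq ?_)
      rw [hm]; ring
  calc ∫⁻ u in {u | 2 * R < ‖u‖}, ψ u ≤ ∫⁻ u in ⋃ m : ℕ, annulus n (2 ^ (m + 1) * R), ψ u :=
        lintegral_mono_set hsub
    _ ≤ ∑' m : ℕ, ∫⁻ u in annulus n (2 ^ (m + 1) * R), ψ u := lintegral_iUnion_le _ _
    _ ≤ _ := ENNReal.tsum_le_tsum fun m => setLIntegral_annulus_le _ (by positivity) _

theorem volume_ball_two_mul {s : ℝ} (hs : 0 < s) :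
    volume (Metric.ball (0 : EuclideanSpace ℝ (Fin n)) (2 * s)) =
      volume (Metric.ball (0 : EuclideanSpace ℝ (Fin n)) 2) * ENNReal.ofReal (s ^ n) := by
  rw [mul_comm 2 s, Measure.addHaar_ball_mul_of_pos volume _ hs, finrank_euclideanSpace_fin,
    mul_comm]

end Annuli

/-! ### Integral forms of the kernel conditions. -/

section Kernels

open BanachSequenceSpace

/-- The factor $(2^{m+1}R)^n$ is the volume of the averaging ball up to $|B(0,2)|$, so the $H_1$ sum
controls the classical Hörmander integral. -/
theorem HormanderClass.exists_setLIntegral_le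
    {n : ℕ} {X : Type*} [NormedAddCommGroup X] {K : EuclideanSpace ℝ (Fin n) → X}
    (hK : HormanderClass (fun t => (t : ℝ≥0∞)) K) :
    ∃ c : ℝ, 1 < c ∧ ∃ C : ℝ≥0, ∀ (h : EuclideanSpace ℝ (Fin n)) (R : ℝ), c * ‖h‖ < R →
      ∫⁻ u in {u | 2 * R < ‖u‖}, ‖K (u - h) - K u‖ₑ ≤ C := by
  obtain ⟨c, hc, C, hC⟩ := hK
  have hvt : volume (Metric.ball (0 : EuclideanSpace ℝ (Fin n)) 2) ≠ ∞ := measure_ball_lt_top.ne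
  refine ⟨c, hc, (volume (Metric.ball (0 : EuclideanSpace ℝ (Fin n)) 2)).toNNReal * C,
    fun h R hR => ?_⟩
  have hR0 : 0 < R := lt_of_le_of_lt (by positivity) hR
  rw [ENNReal.coe_mul, ENNReal.coe_toNNReal hvt]
  refine (setLIntegral_two_mul_lt_norm_le hR0 _).trans (le_trans ?_ (mul_le_mul' le_rfl (hC h R hR)))
  rw [← ENNReal.tsum_mul_left]
  refine ENNReal.tsum_le_tsum fun m => ?_
  have hs : (0 : ℝ) < 2 ^ (m + 1) * R := by positivity
  rw [← mul_assoc (volume _), ← volume_ball_two_mul hs]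
  refine le_trans (le_of_eq ?_) (lintegral_enorm_le_luxNorm_id (mul_pos two_pos hs))
  refine lintegral_congr fun u => ?_
  by_cases hu : u ∈ annulus n (2 ^ (m + 1) * R)
  · rw [Set.indicator_of_mem hu, Set.indicator_of_mem (show u ∈ {y | _} from hu)]
  · rw [Set.indicator_of_notMem hu, Set.indicator_of_notMem (show u ∉ {y | _} from hu), enorm_zero]

variable {n : ℕ} {X : Type*} [NormedAddCommGroup X] [NormedSpace ℝ X] [BanachSequenceSpace X]
  {K : EuclideanSpace ℝ (Fin n) → X}

theorem IsSingularIntegralOperator.aestronglyMeasurable_kernelCoord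
    (hT : IsSingularIntegralOperator K) (l : ℤ) : AEStronglyMeasurable (kernelCoord K l) :=
  (coordCLM X l).continuous.comp_aestronglyMeasurable hT.measurable

/-- Hölder on each annulus: all the balls $B(c,2^{m+2}R)$ contain `z`, so one factor is at most the
maximal function at `z`, uniformly in `m` and `l`. -/
theorem setLIntegral_kernelCoord_sub_mul_le {A : ℝ≥0 → ℝ≥0} (hA : Continuous A) {l : ℤ}
    (hK : AEStronglyMeasurable (kernelCoord K l)) {f : EuclideanSpace ℝ (Fin n) → ℝ}
    {h c z : EuclideanSpace ℝ (Fin n)} {R : ℝ} (hR : 0 < R) (hz : z ∈ Metric.ball c (4 * R))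
    (hd : daggerEntry (fun t => (A t : ℝ≥0∞)) K h R l ≠ ∞)
    (hS : luxMaximal (complementary A) f z ≠ ∞) :
    ∫⁻ u in {u | 2 * R < ‖u‖}, ‖kernelCoord K l (u - h) - kernelCoord K l u‖ₑ * ‖f (c - u)‖ₑ ≤
      2 * volume (Metric.ball (0 : EuclideanSpace ℝ (Fin n)) 2) *
        luxMaximal (complementary A) f z * daggerEntry (fun t => (A t : ℝ≥0∞)) K h R l := by
  refine (setLIntegral_two_mul_lt_norm_le hR _).trans ?_
  rw [daggerEntry, ← ENNReal.tsum_mul_left]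
  refine ENNReal.tsum_le_tsum fun m => ?_
  have hs : (0 : ℝ) < 2 ^ (m + 1) * R := by positivity
  have hdm := ENNReal.ne_top_of_tsum_ne_top hd m
  have hft : luxAnnulus (fun t => (A t : ℝ≥0∞))
      (fun y => kernelCoord K l (y - h) - kernelCoord K l y) (2 ^ (m + 1) * R) ≠ ∞ := by
    intro htop
    rw [htop, ENNReal.mul_top (by simp; positivity)] at hdm
    exact hdm rfl
  have hzm : z ∈ Metric.ball c (2 * (2 ^ (m + 1) * R)) := by
    refine Metric.ball_subset_ball ?_ hz
    have : (2 : ℝ) ^ 1 ≤ 2 ^ (m + 1) := pow_le_pow_right₀ (by norm_num) (by omega)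
    nlinarith
  have hg : luxNorm (complementary A) (fun u => f (c - u)) (Metric.ball 0 (2 * (2 ^ (m + 1) * R)))
      ≤ luxMaximal (complementary A) f z := by
    rw [luxNorm_comp_sub_left]
    exact luxNorm_le_luxMaximal _ _ hzm
  have hm : MeasurableSet (annulus n (2 ^ (m + 1) * R)) :=
    (measurableSet_lt measurable_const measurable_norm).inter
      (measurableSet_le measurable_norm measurable_const)
  have hφ : AEStronglyMeasurable
      (Set.indicator {y : EuclideanSpace ℝ (Fin n) | 2 ^ (m + 1) * R < ‖y‖ ∧
        ‖y‖ ≤ 2 * (2 ^ (m + 1) * R)} fun y => kernelCoord K l (y - h) - kernelCoord K l y) :=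
    ((hK.comp_measurePreserving (measurePreserving_sub_right volume h)).sub hK).indicator hm
  have hH := lintegral_enorm_mul_le_luxNorm hA hφ (c := 0) (mul_pos two_pos hs) hft
    (ne_top_of_le_ne_top hS hg)
  refine le_trans (le_of_eq ?_) (hH.trans ?_)
  · refine lintegral_congr fun u => ?_
    by_cases hu : u ∈ annulus n (2 ^ (m + 1) * R)
    · rw [Set.indicator_of_mem hu, Set.indicator_of_mem (show u ∈ {y | _} from hu)]
    · rw [Set.indicator_of_notMem hu, Set.indicator_of_notMem (show u ∉ {y | _} from hu),
        enorm_zero, zero_mul]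
  · rw [volume_ball_two_mul hs]
    change _ * (luxAnnulus _ _ _ * _) ≤ _
    calc _ ≤ _ * (_ * luxMaximal (complementary A) f z) := by gcongr
      _ = _ := by ring

end Kernels

/-! ### Cancellation away from the support. -/

section FarField

open BanachSequenceSpace

variable {n : ℕ} {X : Type*} [NormedAddCommGroup X] [NormedSpace ℝ X]
  [BanachSequenceSpace X] {K : EuclideanSpace ℝ (Fin n) → X}

theorem aemeasurable_mul_enorm_kernel_sub (hT : IsSingularIntegralOperator K)
    {b : EuclideanSpace ℝ (Fin n) → ℝ} (hb : MemLInftyC b) (c : EuclideanSpace ℝ (Fin n))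
    (U : Set (EuclideanSpace ℝ (Fin n))) :
    AEMeasurable (Function.uncurry fun x y => ‖b y‖ₑ * ‖K (x - y) - K (x - c)‖ₑ)
      ((volume.restrict U).prod volume) := by
  have h1 : AEStronglyMeasurable
      (fun z : EuclideanSpace ℝ (Fin n) × EuclideanSpace ℝ (Fin n) => K (z.1 - z.2))
      (volume.prod volume) :=
    hT.measurable.comp_quasiMeasurePreserving
      (quasiMeasurePreserving_sub_of_right_invariant volume volume)
  have h2 : AEStronglyMeasurable
      (fun z : EuclideanSpace ℝ (Fin n) × EuclideanSpace ℝ (Fin n) => K (z.1 - c))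
      (volume.prod volume) :=
    (hT.measurable.comp_measurePreserving (measurePreserving_sub_right volume c)).comp_fst
  have h3 : AEStronglyMeasurable
      (fun z : EuclideanSpace ℝ (Fin n) × EuclideanSpace ℝ (Fin n) => b z.2)
      (volume.prod volume) := hb.1.aestronglyMeasurable.comp_snd
  have h4 := h3.enorm.mul (h1.sub h2).enorm
  exact h4.mono_ac (Measure.restrict_le_self.absolutelyContinuous.prod
    Measure.AbsolutelyContinuous.rfl)

variable [CompleteSpace X]

/-- As `b` has mean zero, $K(x-c)$ may be subtracted; `v` is then the Bochner integral of the
difference, as comparison of coordinates shows. -/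
theorem enorm_le_lintegral_of_coord_eq (hT : IsSingularIntegralOperator K)
    {b : EuclideanSpace ℝ (Fin n) → ℝ} (hb : MemLInftyC b) (hb0 : ∫ y, b y = 0)
    {x c : EuclideanSpace ℝ (Fin n)} {δ : ℝ} (hδ : 0 < δ) (hx : ∀ y, ‖x - y‖ < δ → b y = 0)
    {v : X} (hv : coord v = singularIntegral K b x) :
    ‖v‖ₑ ≤ ∫⁻ y, ‖b y‖ₑ * ‖K (x - y) - K (x - c)‖ₑ := by
  by_cases htop : ∫⁻ y, ‖b y‖ₑ * ‖K (x - y) - K (x - c)‖ₑ = ∞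
  · rw [htop]; exact le_top
  have hm : AEStronglyMeasurable fun y => b y • (K (x - y) - K (x - c)) :=
    hb.1.aestronglyMeasurable.smul
      ((hT.measurable.comp_measurePreserving (Measure.measurePreserving_sub_left volume x)).sub
        aestronglyMeasurable_const)
  have hint : Integrable fun y => b y • (K (x - y) - K (x - c)) := by
    refine ⟨hm, ?_⟩
    rw [hasFiniteIntegral_iff_enorm]
    simp only [enorm_smul]
    exact lt_top_iff_ne_top.2 htop
  have hvi : v = ∫ y, b y • (K (x - y) - K (x - c)) := by
    refine coord_injective ?_
    rw [hv]
    funext l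
    rw [singularIntegral_eq_integral hδ hx, ← coordCLM_apply l (∫ y, _),
      ← ContinuousLinearMap.integral_comp_comm _ hint]
    have h1 := integrable_kernelCoord_mul (hT.locallyIntegrable l) hb hδ hx
    have h2 : ∀ y, coordCLM X l (b y • (K (x - y) - K (x - c))) =
        kernelCoord K l (x - y) * b y - kernelCoord K l (x - c) * b y := by
      intro y
      simp only [map_smul, map_sub, coordCLM_apply, smul_eq_mul, kernelCoord]
      ring
    simp only [h2]
    rw [integral_sub h1 (hb.integrable.const_mul _), integral_const_mul, hb0, mul_zero, sub_zero]
  rw [hvi]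
  refine (enorm_integral_le_lintegral_enorm _).trans (le_of_eq ?_)
  simp only [enorm_smul]

/-- The image of a function with mean zero is integrable away from its support. -/
theorem IsSingularIntegralOperator.exists_setLIntegral_le_of_integral_eq_zero
    (hT : IsSingularIntegralOperator K) :
    ∃ c : ℝ, 1 < c ∧ ∃ C : ℝ≥0, ∀ (b : EuclideanSpace ℝ (Fin n) → ℝ)
      (F : EuclideanSpace ℝ (Fin n) → X) (x₀ : EuclideanSpace ℝ (Fin n)) (ρ : ℝ), 0 < ρ →
      MemLInftyC b → RepresentsSingularIntegral K b F → (∀ y, y ∉ Metric.ball x₀ ρ → b y = 0) →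
      ∫ y, b y = 0 →
      ∫⁻ x in {x | 2 * (c * ρ) < ‖x - x₀‖}, ‖F x‖ₑ ≤ C * ∫⁻ y, ‖b y‖ₑ := by
  obtain ⟨c, hc, C, hC⟩ := hT.hormander.exists_setLIntegral_le
  refine ⟨c, hc, C, fun b F x₀ ρ hρ hb hF hsupp hb0 => ?_⟩
  set U := {x : EuclideanSpace ℝ (Fin n) | 2 * (c * ρ) < ‖x - x₀‖} with hU
  have hUm : MeasurableSet U := measurableSet_lt measurable_const (by fun_prop)
  have hfar : ∀ x ∈ U, ∀ y, ‖x - y‖ < ρ → b y = 0 := by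
    intro x hx y hxy
    refine hsupp y fun hy => ?_
    have hx' : 2 * (c * ρ) < ‖x - x₀‖ := hx
    rw [mem_ball_iff_norm] at hy
    have := norm_sub_le_norm_sub_add_norm_sub x y x₀
    nlinarith
  calc ∫⁻ x in U, ‖F x‖ₑ
      ≤ ∫⁻ x in U, ∫⁻ y, ‖b y‖ₑ * ‖K (x - y) - K (x - x₀)‖ₑ := by
        refine lintegral_mono_ae ?_
        filter_upwards [ae_restrict_of_ae hF.2, ae_restrict_mem hUm] with x hx hxU
        exact enorm_le_lintegral_of_coord_eq hT hb hb0 hρ (hfar x hxU) hx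
    _ = ∫⁻ y, ∫⁻ x in U, ‖b y‖ₑ * ‖K (x - y) - K (x - x₀)‖ₑ :=
        lintegral_lintegral_swap (aemeasurable_mul_enorm_kernel_sub hT hb x₀ U)
    _ ≤ ∫⁻ y, C * ‖b y‖ₑ := by
        refine lintegral_mono fun y => ?_
        rw [lintegral_const_mul' _ _ enorm_ne_top, mul_comm]
        by_cases hy : y ∈ Metric.ball x₀ ρ
        · gcongr ?_ * _
          rw [mem_ball_iff_norm] at hy
          refine le_trans (le_of_eq ?_) (hC (y - x₀) (c * ρ) (by gcongr))
          have := (measurePreserving_sub_right volume x₀).setLIntegral_comp_preimage_emb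
            (Homeomorph.subRight x₀).measurableEmbedding
            (fun u => ‖K (u - (y - x₀)) - K u‖ₑ) {u | 2 * (c * ρ) < ‖u‖}
          rw [← this]
          refine lintegral_congr fun x => ?_
          rw [sub_sub_sub_cancel_right]
        · rw [hsupp y hy]; simp
    _ = _ := lintegral_const_mul' _ _ ENNReal.coe_ne_top

end FarField

/-! ### Stopping balls. -/

section CalderonZygmund

theorem exists_bound_of_mul_measure_ball_lt {V : Type*} [NormedAddCommGroup V] [NormedSpace ℝ V]
    [FiniteDimensional ℝ V] [MeasurableSpace V] [BorelSpace V] [Nontrivial V] (μ : Measure V)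
    [μ.IsAddHaarMeasure] {α : ℝ≥0} (hα : 0 < α) {I : ℝ≥0∞} (hI : I ≠ ∞) :
    ∃ R : ℝ, ∀ (c : V) (r : ℝ), 0 < r → α * μ (Metric.ball c r) < I → r ≤ R := by
  have hv0 : μ (Metric.ball (0 : V) 1) ≠ 0 := (Metric.measure_ball_pos μ _ one_pos).ne'
  have hvt : μ (Metric.ball (0 : V) 1) ≠ ∞ := measure_ball_lt_top.ne
  have hk0 : (α : ℝ≥0∞) * μ (Metric.ball (0 : V) 1) ≠ 0 := mul_ne_zero (by simpa using hα.ne') hv0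
  have hkt : (α : ℝ≥0∞) * μ (Metric.ball (0 : V) 1) ≠ ∞ := ENNReal.mul_ne_top ENNReal.coe_ne_top hvt
  refine ⟨max 1 ((α * μ (Metric.ball (0 : V) 1))⁻¹ * I).toReal, fun c r hr h => ?_⟩
  rcases le_total r 1 with h1 | h1
  · exact le_max_of_le_left h1
  · refine le_max_of_le_right ?_
    rw [← ENNReal.ofReal_le_iff_le_toReal
      (ENNReal.mul_ne_top (ENNReal.inv_ne_top.2 hk0) hI)]
    rw [Measure.addHaar_ball_of_pos μ c hr, mul_left_comm] at h
    have h2 : ENNReal.ofReal r ≤ ENNReal.ofReal (r ^ Module.finrank ℝ V) :=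
      ENNReal.ofReal_le_ofReal (le_self_pow₀ h1 Module.finrank_pos.ne')
    calc ENNReal.ofReal r ≤ ENNReal.ofReal (r ^ Module.finrank ℝ V) := h2
      _ = (α * μ (Metric.ball (0 : V) 1))⁻¹ *
          (ENNReal.ofReal (r ^ Module.finrank ℝ V) * (α * μ (Metric.ball (0 : V) 1))) := by
        rw [mul_left_comm, ENNReal.inv_mul_cancel hk0 hkt, mul_one]
      _ ≤ _ := by gcongr

variable {V : Type*} [NormedAddCommGroup V] [NormedSpace ℝ V]
  [FiniteDimensional ℝ V] [MeasurableSpace V] [BorelSpace V] [Nontrivial V] {μ : Measure V}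
  [μ.IsAddHaarMeasure]

/-- Lebesgue differentiation, with closed balls replaced by open ones up to null spheres. -/
theorem ae_exists_lt_setLIntegral_ball {ψ : V → ℝ≥0∞} (hψ : AEMeasurable ψ μ)
    (hI : ∫⁻ x, ψ x ∂μ ≠ ∞) (α : ℝ≥0) :
    ∀ᵐ x ∂μ, α < ψ x → ∃ r : ℝ, 0 < r ∧
      α * μ (Metric.ball x r) < ∫⁻ y in Metric.ball x r, ψ y ∂μ := by
  have : ProperSpace V := FiniteDimensional.proper_real V
  filter_upwards [(Besicovitch.vitaliFamily μ).ae_tendsto_lintegral_div hψ hI] with x hx hlt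
  obtain ⟨r, hr, hr0 : 0 < r⟩ := (((hx.comp (Besicovitch.tendsto_filterAt μ x)).eventually
    (lt_mem_nhds hlt)).and self_mem_nhdsWithin).exists
  refine ⟨r, hr0, ?_⟩
  simp only [Function.comp_apply] at hr
  have hae : (Metric.closedBall x r : Set V) =ᵐ[μ] (Metric.ball x r : Set V) := by
    have hs : ∀ᵐ y ∂μ, y ∉ Metric.sphere x r := measure_eq_zero_iff_ae_notMem.1
      (Measure.addHaar_sphere μ x r)
    filter_upwards [hs] with y hy
    exact propext ⟨fun h => lt_of_le_of_ne h hy, fun h => Metric.ball_subset_closedBall h⟩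
  rwa [ENNReal.lt_div_iff_mul_lt (Or.inl (Metric.measure_closedBall_pos μ x hr0).ne')
    (Or.inl measure_closedBall_lt_top.ne), Measure.addHaar_closedBall_eq_addHaar_ball,
    setLIntegral_congr hae] at hr

/-- The balls on which a Calderón–Zygmund decomposition at height `α` is based. -/
theorem exists_calderonZygmund_balls {ψ : V → ℝ≥0∞} (hψ : AEMeasurable ψ μ)
    (hI : ∫⁻ x, ψ x ∂μ ≠ ∞) {α : ℝ≥0} (hα : 0 < α) {η : ℝ≥0∞} (hη : 0 < η) :
    ∃ (m : ℕ) (x : Fin m → V) (r : Fin m → ℝ), (∀ i, 0 < r i) ∧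
      (Pairwise fun i j => Disjoint (Metric.ball (x i) (r i)) (Metric.ball (x j) (r j))) ∧
      (∀ i, α * μ (Metric.ball (x i) (r i)) ≤ ∫⁻ y in Metric.ball (x i) (r i), ψ y ∂μ) ∧
      (∀ i, ∫⁻ y in Metric.ball (x i) (6 * r i), ψ y ∂μ ≤ α * μ (Metric.ball (x i) (6 * r i))) ∧
      μ ({y | α < ψ y} \ ⋃ i, Metric.ball (x i) (6 * r i)) ≤ η := by
  obtain ⟨R, hR⟩ := exists_bound_of_mul_measure_ball_lt μ hα hI
  -- Stopping condition: the average exceeds `α`, but no longer does once the radius is at least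
  -- doubled. This covers the sixfold dilates from Vitali's lemma.
  set t : Set (V × ℝ) := {b | 0 < b.2 ∧
    α * μ (Metric.ball b.1 b.2) < ∫⁻ y in Metric.ball b.1 b.2, ψ y ∂μ ∧
    ∀ ρ, 2 * b.2 ≤ ρ → ∫⁻ y in Metric.ball b.1 ρ, ψ y ∂μ ≤ α * μ (Metric.ball b.1 ρ)} with ht
  have hRt : ∀ (c : V) (r : ℝ), 0 < r →
      α * μ (Metric.ball c r) < ∫⁻ y in Metric.ball c r, ψ y ∂μ → r ≤ R := fun c r hr h =>
    hR c r hr (h.trans_le (setLIntegral_le_lintegral _ _))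
  obtain ⟨u, hut, huc, hdisj, hcov⟩ := exists_countable_disjoint_subfamily_ball t
    (fun b hb => hb.1) R fun b hb => hRt b.1 b.2 hb.1 hb.2.1
  have hae : ∀ᵐ y ∂μ, α < ψ y → y ∈ ⋃ b ∈ u, Metric.ball b.1 (6 * b.2) := by
    filter_upwards [ae_exists_lt_setLIntegral_ball hψ hI α] with y hy hlt
    obtain ⟨r₀, hr₀, hlt₀⟩ := hy hlt
    set P : Set ℝ := {r | 0 < r ∧ α * μ (Metric.ball y r) < ∫⁻ z in Metric.ball y r, ψ z ∂μ} with hP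
    have hPb : BddAbove P := ⟨R, fun r hr => hRt y r hr.1 hr.2⟩
    have hsup : r₀ ≤ sSup P := le_csSup hPb ⟨hr₀, hlt₀⟩
    -- A radius above half the supremum: doubling it leaves `P`.
    obtain ⟨r, hrP, hr⟩ := exists_lt_of_lt_csSup (s := P) ⟨r₀, hr₀, hlt₀⟩
      (show sSup P / 2 < sSup P by linarith)
    refine hcov (Set.mem_biUnion (x := (y, r)) ⟨hrP.1, hrP.2, fun ρ hρ => ?_⟩
      (Metric.mem_ball_self hrP.1))
    by_contra! h
    have hrp := hrP.1
    have := le_csSup hPb (show ρ ∈ P from ⟨by simp only at hρ; linarith, h⟩)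
    simp only at hρ
    linarith
  have hscale : ∀ b : V × ℝ, μ (Metric.ball b.1 (6 * b.2)) =
      ENNReal.ofReal (6 ^ Module.finrank ℝ V) * μ (Metric.ball b.1 b.2) := fun b => by
    rw [Measure.addHaar_ball_mul_of_pos μ _ (by norm_num), ← Measure.addHaar_ball_center μ b.1]
  have hαi : (α : ℝ≥0∞)⁻¹ ≠ ∞ := ENNReal.inv_ne_top.2 (by simpa using hα.ne')
  have : Countable u := huc
  have hsum : ∑' b : u, μ (Metric.ball b.1.1 (6 * b.1.2)) ≠ ∞ := by
    simp only [hscale]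
    rw [ENNReal.tsum_mul_left]
    refine ENNReal.mul_ne_top ENNReal.ofReal_ne_top (ne_top_of_le_ne_top
      (ENNReal.mul_ne_top hαi hI) ?_)
    calc ∑' b : u, μ (Metric.ball b.1.1 b.1.2)
        ≤ ∑' b : u, (α : ℝ≥0∞)⁻¹ * ∫⁻ y in Metric.ball b.1.1 b.1.2, ψ y ∂μ := by
          refine ENNReal.tsum_le_tsum fun b => ?_
          rw [mul_comm, ← div_eq_mul_inv, ENNReal.le_div_iff_mul_le (by simp [hα.ne']) (by simp),
            mul_comm]
          exact (hut b.2).2.1.le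
      _ = (α : ℝ≥0∞)⁻¹ * ∫⁻ y in ⋃ b ∈ u, Metric.ball b.1 b.2, ψ y ∂μ := by
          rw [ENNReal.tsum_mul_left, lintegral_biUnion huc (fun _ _ => measurableSet_ball) hdisj]
      _ ≤ _ := by
          gcongr
          exact Measure.restrict_le_self
  -- Keeping finitely many balls costs a set of measure at most `η`; then only finite additivity of
  -- $T$ is required.
  obtain ⟨s, hs⟩ := ((tendsto_order.1 (ENNReal.tendsto_tsum_compl_atTop_zero hsum)).2 η hη).exists
  refine ⟨s.card, fun i => (s.equivFin.symm i).1.1.1, fun i => (s.equivFin.symm i).1.1.2,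
    fun i => (hut (s.equivFin.symm i).1.2).1, fun i j hij => ?_,
    fun i => (hut (s.equivFin.symm i).1.2).2.1.le, fun i => ?_, ?_⟩
  · refine hdisj (s.equivFin.symm i).1.2 (s.equivFin.symm j).1.2 fun h => hij ?_
    exact s.equivFin.symm.injective (Subtype.ext (Subtype.ext h))
  · have h0 := (hut (s.equivFin.symm i).1.2).1
    exact (hut (s.equivFin.symm i).1.2).2.2 _ (by linarith)
  · refine le_trans (measure_mono_ae ?_) ((measure_iUnion_le
      (fun b : {b : u // b ∉ s} => Metric.ball b.1.1.1 (6 * b.1.1.2))).trans hs.le)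
    filter_upwards [hae] with y hy hyl
    obtain ⟨b, hb, hyb⟩ := Set.mem_iUnion₂.1 (hy hyl.1)
    refine Set.mem_iUnion.2 ⟨⟨⟨b, hb⟩, fun hbs => hyl.2 ?_⟩, hyb⟩
    refine Set.mem_iUnion.2 ⟨s.equivFin ⟨⟨b, hb⟩, hbs⟩, ?_⟩
    simpa using hyb

end CalderonZygmund

/-! ### The Calderón–Zygmund decomposition. -/

section Decomposition

variable {n : ℕ}

theorem enorm_sum_indicator_ball_le {m : ℕ} {V : Type*} [PseudoMetricSpace V] {x : Fin m → V}
    {r : Fin m → ℝ}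
    (hdisj : Pairwise fun i j => Disjoint (Metric.ball (x i) (r i)) (Metric.ball (x j) (r j)))
    {a : Fin m → ℝ} {C : ℝ≥0∞} (ha : ∀ i, ‖a i‖ₑ ≤ C) (y : V) :
    ‖∑ i, (Metric.ball (x i) (r i)).indicator (fun _ => a i) y‖ₑ ≤ C := by
  by_cases hy : ∃ i, y ∈ Metric.ball (x i) (r i)
  · obtain ⟨i, hi⟩ := hy
    rw [Finset.sum_eq_single i, Set.indicator_of_mem hi]
    · exact ha i
    · intro j _ hji
      exact Set.indicator_of_notMem (fun hj => Set.disjoint_left.1 (hdisj hji) hj hi) _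
    · simp
  · push Not at hy
    rw [Finset.sum_eq_zero fun i _ => Set.indicator_of_notMem (hy i) _]
    simp

/-- A Calderón–Zygmund decomposition with finitely many bad functions, up to a small error `e`. -/
theorem MemLInftyC.exists_calderonZygmund [NeZero n] {f : EuclideanSpace ℝ (Fin n) → ℝ}
    (hf : MemLInftyC f) {α : ℝ≥0} (hα : 0 < α) {η : ℝ≥0∞} (hη : 0 < η) {q : ℝ} (hq : 0 < q) :
    ∃ (m : ℕ) (x : Fin m → EuclideanSpace ℝ (Fin n)) (r : Fin m → ℝ)
      (b : Fin m → EuclideanSpace ℝ (Fin n) → ℝ) (g e : EuclideanSpace ℝ (Fin n) → ℝ),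
      f = (∑ i, b i) + (g + e) ∧ (∀ i, 0 < r i) ∧ (∀ i, MemLInftyC (b i)) ∧ MemLInftyC g ∧
      MemLInftyC e ∧ (∀ i y, y ∉ Metric.ball (x i) (6 * r i) → b i y = 0) ∧
      (∀ i, ∫ y, b i y = 0) ∧ ∑ i, ∫⁻ y, ‖b i y‖ₑ ≤ 2 * ∫⁻ y, ‖f y‖ₑ ∧
      α * ∑ i, volume (Metric.ball (x i) (r i)) ≤ ∫⁻ y, ‖f y‖ₑ ∧
      (∀ y, ‖g y‖ₑ ≤ (6 ^ n + 1) * α) ∧ ∫⁻ y, ‖g y‖ₑ ≤ 2 * ∫⁻ y, ‖f y‖ₑ ∧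
      ∫⁻ y, ‖e y‖ₑ ^ q ≤ eLpNorm f ∞ volume ^ q * η := by
  have hfI : Integrable f := hf.integrable
  have hI : ∫⁻ y, ‖f y‖ₑ ≠ ∞ := hfI.2.ne
  have hfm : AEMeasurable fun y => ‖f y‖ₑ := hfI.1.enorm
  obtain ⟨m, x, r, hr, hdisj, hlow, hup, hsmall⟩ :=
    exists_calderonZygmund_balls (μ := volume) hfm hI hα hη
  set B : Fin m → Set (EuclideanSpace ℝ (Fin n)) := fun i => Metric.ball (x i) (r i) with hB
  set Q : Fin m → Set (EuclideanSpace ℝ (Fin n)) := fun i => Metric.ball (x i) (6 * r i) with hQ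
  set E := disjointed Q with hE
  have hEQ : ∀ i, E i ⊆ Q i := fun i => disjointed_subset Q i
  have hEU : ⋃ i, E i = ⋃ i, Q i := iUnion_disjointed
  have hEd : Pairwise (Function.onFun Disjoint E) := disjoint_disjointed Q
  have hEm : ∀ i, MeasurableSet (E i) := fun i =>
    disjointedRec (fun _ _ h => h.diff measurableSet_ball) measurableSet_ball
  have hUm : MeasurableSet (⋃ i, Q i) := MeasurableSet.iUnion fun i => measurableSet_ball
  set U := ⋃ i, Q i with hU
  -- A measurable hull, so that $|f|\le\alpha$ holds at every point outside $U\cup T$.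
  set T := toMeasurable volume ({y | α < ‖f y‖ₑ} \ U) with hT
  have hTm : MeasurableSet T := measurableSet_toMeasurable _ _
  have hTη : volume T ≤ η := by rw [hT, measure_toMeasurable]; exact hsmall
  have hBv : ∀ i, volume (B i) ≠ 0 := fun i => (Metric.measure_ball_pos volume _ (hr i)).ne'
  have hBt : ∀ i, volume (B i) ≠ ∞ := fun i => measure_ball_lt_top.ne
  -- The integral over the piece `E i` of the dilate is spread over the original ball `B i`. These
  -- balls are disjoint, so the constants do not add up in `g`; the volume ratio costs a factor
  -- $6^n$.
  set a : Fin m → ℝ := fun i => (∫ y in E i, f y) / (volume (B i)).toReal with ha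
  set h : Fin m → EuclideanSpace ℝ (Fin n) → ℝ := fun i => (B i).indicator fun _ => a i with hh
  have hhC : ∀ i, MemLInftyC (h i) := fun i => memLInftyC_indicator_ball_const _ _ _
  have hav : ∀ i, ‖a i‖ₑ * volume (B i) ≤ ∫⁻ y in E i, ‖f y‖ₑ := by
    intro i
    have h1 : 0 < (volume (B i)).toReal := ENNReal.toReal_pos (hBv i) (hBt i)
    have h2 : ‖a i‖ₑ * volume (B i) = ‖∫ y in E i, f y‖ₑ := by
      conv_lhs => rw [← ENNReal.ofReal_toReal (hBt i), ← Real.enorm_of_nonneg h1.le, ← enorm_mul]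
      rw [ha]
      congr 1
      exact div_mul_cancel₀ _ h1.ne'
    rw [h2]
    exact enorm_integral_le_lintegral_enorm _
  have haα : ∀ i, ‖a i‖ₑ ≤ 6 ^ n * α := by
    intro i
    have h1 : ‖a i‖ₑ * volume (B i) ≤ 6 ^ n * α * volume (B i) := by
      refine (hav i).trans ((lintegral_mono_set (hEQ i)).trans ((hup i).trans (le_of_eq ?_)))
      rw [Measure.addHaar_ball_mul_of_pos volume _ (by norm_num), ← Measure.addHaar_ball_center volume (x i),
        finrank_euclideanSpace_fin, ENNReal.ofReal_pow (by norm_num), ENNReal.ofReal_ofNat]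
      ring
    exact (ENNReal.mul_le_mul_iff_left (hBv i) (hBt i)).1 h1
  have hhI : ∀ i, ∫⁻ y, ‖h i y‖ₑ = ‖a i‖ₑ * volume (B i) := by
    intro i
    have : ∀ y, ‖h i y‖ₑ = (B i).indicator (fun _ => ‖a i‖ₑ) y := fun y =>
      enorm_indicator_eq_indicator_enorm _ _
    simp only [this]
    rw [lintegral_indicator measurableSet_ball, setLIntegral_const]
  have hsumE : ∑ i, ∫⁻ y in E i, ‖f y‖ₑ ≤ ∫⁻ y, ‖f y‖ₑ := by
    have h1 := lintegral_iUnion (μ := volume) hEm hEd fun y => ‖f y‖ₑ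
    rw [tsum_fintype] at h1
    rw [← h1]
    exact setLIntegral_le_lintegral _ _
  have hEf : ∀ i, ∫⁻ y, ‖(E i).indicator f y‖ₑ = ∫⁻ y in E i, ‖f y‖ₑ := by
    intro i
    simp only [enorm_indicator_eq_indicator_enorm]
    rw [lintegral_indicator (hEm i)]
  set g : EuclideanSpace ℝ (Fin n) → ℝ := (∑ i, h i) + (U ∪ T)ᶜ.indicator f with hg
  have hgm : ∀ i, AEMeasurable fun y => ‖h i y‖ₑ := fun i => (hhC i).1.aestronglyMeasurable.enorm
  refine ⟨m, x, r, fun i => (E i).indicator f - h i, g, (T \ U).indicator f, ?_, hr, ?_, ?_, ?_,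
    ?_, ?_, ?_, ?_, ?_, ?_, ?_⟩
  · have h1 : ∀ y, ∑ i, (E i).indicator f y = U.indicator f y := by
      intro y
      by_cases hy : y ∈ U
      · obtain ⟨i, hi⟩ := Set.mem_iUnion.1 (hEU.symm ▸ hy)
        rw [Finset.sum_eq_single i, Set.indicator_of_mem hi, Set.indicator_of_mem hy]
        · intro j _ hji
          exact Set.indicator_of_notMem (fun hj => Set.disjoint_left.1 (hEd hji) hj hi) _
        · simp
      · rw [Set.indicator_of_notMem hy]
        refine Finset.sum_eq_zero fun i _ => Set.indicator_of_notMem (fun hi => hy ?_) _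
        exact Set.mem_iUnion.2 ⟨i, hEQ i hi⟩
    funext y
    simp only [hg, Pi.add_apply, Finset.sum_apply, Pi.sub_apply, Finset.sum_sub_distrib, h1]
    by_cases hyU : y ∈ U
    · simp [hyU]
    · by_cases hyT : y ∈ T <;> simp [hyU, hyT]
  · exact fun i => (hf.indicator (hEm i)).sub (hhC i)
  · exact (MemLInftyC.sum _ fun i _ => hhC i).add (hf.indicator (hUm.union hTm).compl)
  · exact hf.indicator (hTm.diff hUm)
  · intro i y hy
    have h1 : y ∉ E i := fun h => hy (hEQ i h)
    have h2 : y ∉ B i := fun h => hy (Metric.ball_subset_ball (by linarith [hr i]) h)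
    simp [hh, h1, h2]
  · intro i
    simp only [Pi.sub_apply]
    rw [integral_sub (hf.indicator (hEm i)).integrable (hhC i).integrable,
      integral_indicator (hEm i), integral_indicator measurableSet_ball, setIntegral_const,
      smul_eq_mul, ha, Measure.real]
    simp only
    rw [mul_div_cancel₀ _ (ENNReal.toReal_pos (hBv i) (hBt i)).ne', sub_self]
  · calc ∑ i, ∫⁻ y, ‖((E i).indicator f - h i) y‖ₑ
        ≤ ∑ i, 2 * ∫⁻ y in E i, ‖f y‖ₑ := by
          refine Finset.sum_le_sum fun i _ => ?_
          calc ∫⁻ y, ‖((E i).indicator f - h i) y‖ₑ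
              ≤ ∫⁻ y, (‖(E i).indicator f y‖ₑ + ‖h i y‖ₑ) :=
                lintegral_mono fun y => enorm_sub_le
            _ = (∫⁻ y in E i, ‖f y‖ₑ) + ‖a i‖ₑ * volume (B i) := by
                rw [lintegral_add_right' _ (hgm i), hEf, hhI]
            _ ≤ (∫⁻ y in E i, ‖f y‖ₑ) + ∫⁻ y in E i, ‖f y‖ₑ := add_le_add le_rfl (hav i)
            _ = _ := (two_mul _).symm
      _ = 2 * ∑ i, ∫⁻ y in E i, ‖f y‖ₑ := by rw [Finset.mul_sum]
      _ ≤ _ := by gcongr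
  · rw [Finset.mul_sum]
    refine (Finset.sum_le_sum fun i _ => hlow i).trans ?_
    have h1 := lintegral_iUnion (μ := volume) (fun i => measurableSet_ball) hdisj fun y => ‖f y‖ₑ
    rw [tsum_fintype] at h1
    rw [← h1]
    exact setLIntegral_le_lintegral _ _
  · intro y
    rw [hg, Pi.add_apply, Finset.sum_apply, add_mul, one_mul]
    refine (enorm_add_le _ _).trans (add_le_add (enorm_sum_indicator_ball_le hdisj haα y) ?_)
    by_cases hy : y ∈ U ∪ T
    · rw [Set.indicator_of_notMem (Set.notMem_compl_iff.2 hy), enorm_zero]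
      exact zero_le
    · rw [Set.indicator_of_mem hy]
      by_contra! hlt
      exact hy (Or.inr (subset_toMeasurable _ _ ⟨hlt, fun h => hy (Or.inl h)⟩))
  · calc ∫⁻ y, ‖g y‖ₑ ≤ ∫⁻ y, (∑ i, ‖h i y‖ₑ + ‖f y‖ₑ) := by
          refine lintegral_mono fun y => ?_
          rw [hg, Pi.add_apply, Finset.sum_apply]
          refine (enorm_add_le _ _).trans (add_le_add (enorm_sum_le _ _) ?_)
          rw [enorm_indicator_eq_indicator_enorm]
          exact Set.indicator_le_self _ _ _
      _ = (∑ i, ∫⁻ y, ‖h i y‖ₑ) + ∫⁻ y, ‖f y‖ₑ := by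
          rw [lintegral_add_right' _ hfm, lintegral_finsetSum' _ fun i _ => hgm i]
      _ ≤ (∑ i, ∫⁻ y in E i, ‖f y‖ₑ) + ∫⁻ y, ‖f y‖ₑ :=
          add_le_add (Finset.sum_le_sum fun i _ => (hhI i).le.trans (hav i)) le_rfl
      _ ≤ _ := by rw [two_mul]; exact add_le_add hsumE le_rfl
  · have h1 : ∀ᵐ y, ‖(T \ U).indicator f y‖ₑ ^ q ≤
        T.indicator (fun _ => eLpNorm f ∞ volume ^ q) y := by
      filter_upwards [ae_le_eLpNormEssSup (f := f) (μ := volume)] with y hy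
      by_cases hyT : y ∈ T \ U
      · rw [Set.indicator_of_mem hyT, Set.indicator_of_mem hyT.1, eLpNorm_exponent_top]
        gcongr
      · rw [Set.indicator_of_notMem hyT, enorm_zero, ENNReal.zero_rpow_of_pos hq]
        exact zero_le
    refine (lintegral_mono_ae h1).trans ?_
    rw [lintegral_indicator hTm, setLIntegral_const]
    gcongr

end Decomposition

/-! ### Weak type $(1,1)$. -/

section WeakType

open BanachSequenceSpace

variable {n : ℕ} [NeZero n] {X : Type*} [NormedAddCommGroup X] [NormedSpace ℝ X] [CompleteSpace X]
  [BanachSequenceSpace X] {K : EuclideanSpace ℝ (Fin n) → X}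

/-- Vector-valued singular integral operators are of weak type `(1, 1)`. -/
theorem IsSingularIntegralOperator.exists_weakType (hT : IsSingularIntegralOperator K) :
    ∃ C : ℝ≥0, ∀ (f : EuclideanSpace ℝ (Fin n) → ℝ) (F : EuclideanSpace ℝ (Fin n) → X) (α : ℝ≥0),
      0 < α → MemLInftyC f → RepresentsSingularIntegral K f F →
      α * volume {x | α < ‖F x‖ₑ} ≤ C * ∫⁻ y, ‖f y‖ₑ := by
  obtain ⟨p, hp, C₀, hC₀⟩ := hT.exists_lintegral_rpow_le
  obtain ⟨c, hc, C₁, hC₁⟩ := hT.exists_setLIntegral_le_of_integral_eq_zero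
  have hp0 : 0 < p := by linarith
  have hp1 : 0 < p - 1 := by linarith
  have markov : ∀ (H : EuclideanSpace ℝ (Fin n) → X) (α : ℝ≥0), 0 < α →
      AEStronglyMeasurable H → α * volume {x | α < ‖H x‖ₑ} ≤
        ((α : ℝ≥0∞) ^ (p - 1))⁻¹ * ∫⁻ x, ‖H x‖ₑ ^ p := by
    intro H α hα hH
    have hα0 : (α : ℝ≥0∞) ≠ 0 := by simpa using hα.ne'
    have h0 : (α : ℝ≥0∞) ^ (p - 1) ≠ 0 := by simp [hα.ne']
    have ht : (α : ℝ≥0∞) ^ (p - 1) ≠ ∞ := ENNReal.rpow_ne_top_of_nonneg hp1.le ENNReal.coe_ne_top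
    have h1 := mul_meas_ge_le_lintegral₀ (hH.enorm.pow_const p) ((α : ℝ≥0∞) ^ p)
    have h2 : (α : ℝ≥0∞) ^ p = (α : ℝ≥0∞) ^ (p - 1) * α := by
      conv_rhs => rw [← ENNReal.rpow_one (α : ℝ≥0∞), ← ENNReal.rpow_mul, one_mul,
        ← ENNReal.rpow_add _ _ hα0 ENNReal.coe_ne_top, sub_add_cancel]
    rw [mul_comm _ (∫⁻ x, ‖H x‖ₑ ^ p), ← div_eq_mul_inv,
      ENNReal.le_div_iff_mul_le (Or.inl h0) (Or.inl ht), mul_comm, ← mul_assoc, ← h2]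
    refine le_trans ?_ h1
    gcongr with x
    exact fun h => ENNReal.rpow_le_rpow h.le hp0.le
  set D : ℝ≥0∞ := (6 ^ n + 1) ^ (p - 1) with hD
  have hDt : D ≠ ∞ := ENNReal.rpow_ne_top_of_nonneg hp1.le (by finiteness)
  set L : ℝ≥0∞ := ENNReal.ofReal ((12 * c) ^ n) with hL
  have hLt : L ≠ ∞ := ENNReal.ofReal_ne_top
  have key : ∀ (f : EuclideanSpace ℝ (Fin n) → ℝ) (F : EuclideanSpace ℝ (Fin n) → X) (α : ℝ≥0),
      0 < α → MemLInftyC f → RepresentsSingularIntegral K f F →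
      α * volume {x | (3 * α : ℝ≥0) < ‖F x‖ₑ} ≤
        (L + 2 * C₁ + 2 * C₀ * D) * ∫⁻ y, ‖f y‖ₑ := by
    intro f F α hα hf hF
    have hα0 : (α : ℝ≥0∞) ≠ 0 := by simpa using hα.ne'
    have hαp0 : (α : ℝ≥0∞) ^ (p - 1) ≠ 0 := by simp [hα.ne']
    have hαpt : (α : ℝ≥0∞) ^ (p - 1) ≠ ∞ :=
      ENNReal.rpow_ne_top_of_nonneg hp1.le ENNReal.coe_ne_top
    set κ : ℝ≥0∞ := ((α : ℝ≥0∞) ^ (p - 1))⁻¹ * (C₀ * eLpNorm f ∞ volume ^ p) with hκ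
    have hκt : κ ≠ ∞ := ENNReal.mul_ne_top (ENNReal.inv_ne_top.2 hαp0)
      (ENNReal.mul_ne_top ENNReal.coe_ne_top
        (ENNReal.rpow_ne_top_of_nonneg hp0.le hf.1.eLpNorm_ne_top))
    refine ENNReal.le_of_forall_pos_le_add fun δ hδ _ => ?_
    -- The error has small support and is bounded, so the strong type makes its contribution at most
    -- `κ * η`, hence at most `δ`; the summand $1$ avoids division by zero.
    have hη : 0 < (δ : ℝ≥0∞) / (κ + 1) :=
      ENNReal.div_pos (by simpa using hδ.ne') (by finiteness)
    obtain ⟨m, x, r, b, g, e, hfe, hr, hb, hg, he, hbs, hb0, hbI, hvol, hgα, hgI, heI⟩ :=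
      hf.exists_calderonZygmund hα hη hp0
    choose Fb hFb using fun i => hT.exists_represents (hb i)
    obtain ⟨Fg, hFg⟩ := hT.exists_represents hg
    obtain ⟨Fe, hFe⟩ := hT.exists_represents he
    have hFs : RepresentsSingularIntegral K f (∑ i, Fb i + (Fg + Fe)) := by
      rw [hfe]
      exact RepresentsSingularIntegral.add hT (MemLInftyC.sum _ fun i _ => hb i) (hg.add he)
        (RepresentsSingularIntegral.sum hT _ (fun i _ => hb i) fun i _ => hFb i)
        (RepresentsSingularIntegral.add hT hg he hFg hFe)
    have hsplit : volume {x | (3 * α : ℝ≥0) < ‖F x‖ₑ} ≤ volume {x | α < ∑ i, ‖Fb i x‖ₑ} +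
        (volume {x | α < ‖Fg x‖ₑ} + volume {x | α < ‖Fe x‖ₑ}) := by
      refine le_trans (measure_mono_ae ?_) ((measure_union_le _ _).trans
        (add_le_add_right (measure_union_le _ _) _))
      filter_upwards [hF.ae_eq hFs] with y hy (hlt : ((3 * α : ℝ≥0) : ℝ≥0∞) < ‖F y‖ₑ)
      by_contra hno
      obtain ⟨h1, h23⟩ := not_or.1 hno
      obtain ⟨h2, h3⟩ := not_or.1 h23
      have h4 : ‖F y‖ₑ ≤ ∑ i, ‖Fb i y‖ₑ + (‖Fg y‖ₑ + ‖Fe y‖ₑ) := by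
        rw [hy, Pi.add_apply, Pi.add_apply, Finset.sum_apply]
        exact (enorm_add_le _ _).trans (add_le_add (enorm_sum_le _ _) (enorm_add_le _ _))
      refine absurd hlt (not_lt.2 (h4.trans ?_))
      calc _ ≤ (α : ℝ≥0∞) + (α + α) := by
            gcongr
            · exact not_lt.1 h1
            · exact not_lt.1 h2
            · exact not_lt.1 h3
        _ = _ := by push_cast; ring
    have hbad : α * volume {x | α < ∑ i, ‖Fb i x‖ₑ} ≤ (L + 2 * C₁) * ∫⁻ y, ‖f y‖ₑ := by
      -- The bad functions live on balls of radius $6r_i$, and their images are integrable beyond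
      -- $2c\cdot6r_i$.
      set W : Set (EuclideanSpace ℝ (Fin n)) := ⋃ i, Metric.closedBall (x i) (12 * c * r i) with hW
      have hWm : MeasurableSet W := MeasurableSet.iUnion fun i => measurableSet_closedBall
      have h1 : volume W ≤ L * ∑ i, volume (Metric.ball (x i) (r i)) := by
        refine (measure_iUnion_le _).trans ?_
        rw [tsum_fintype, Finset.mul_sum]
        refine Finset.sum_le_sum fun i _ => le_of_eq ?_
        rw [Measure.addHaar_closedBall_eq_addHaar_ball,
          Measure.addHaar_ball_mul_of_pos volume _ (by positivity),
          ← Measure.addHaar_ball_center volume (x i), finrank_euclideanSpace_fin]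
      have h2 : ∫⁻ y in Wᶜ, ∑ i, ‖Fb i y‖ₑ ≤ C₁ * (2 * ∫⁻ y, ‖f y‖ₑ) := by
        rw [lintegral_finsetSum' _ fun i _ => (hFb i).1.enorm.restrict]
        calc ∑ i, ∫⁻ y in Wᶜ, ‖Fb i y‖ₑ ≤ ∑ i, C₁ * ∫⁻ y, ‖b i y‖ₑ := by
              refine Finset.sum_le_sum fun i _ => ?_
              refine le_trans (lintegral_mono_set ?_) (hC₁ (b i) (Fb i) (x i) (6 * r i)
                (by linarith [hr i]) (hb i) (hFb i) (hbs i) (hb0 i))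
              intro y hy
              have h3 : y ∉ Metric.closedBall (x i) (12 * c * r i) := fun h =>
                hy (Set.mem_iUnion.2 ⟨i, h⟩)
              rw [Metric.mem_closedBall, dist_eq_norm, not_le] at h3
              show 2 * (c * (6 * r i)) < ‖y - x i‖
              linarith
          _ ≤ _ := by
              rw [← Finset.mul_sum]
              gcongr
      have h3 : volume {x | α < ∑ i, ‖Fb i x‖ₑ} ≤ volume W +
          volume.restrict Wᶜ {x | α ≤ ∑ i, ‖Fb i x‖ₑ} := by
        rw [Measure.restrict_apply' hWm.compl]
        refine le_trans (measure_mono fun y (hy : α < ∑ i, ‖Fb i y‖ₑ) => ?_) (measure_union_le _ _)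
        by_cases hyW : y ∈ W
        · exact Or.inl hyW
        · exact Or.inr ⟨hy.le, hyW⟩
      have h4 := mul_meas_ge_le_lintegral₀ (μ := volume.restrict Wᶜ)
        (Finset.aemeasurable_fun_sum Finset.univ fun i _ => (hFb i).1.enorm.restrict) (α : ℝ≥0∞)
      calc α * volume {x | α < ∑ i, ‖Fb i x‖ₑ}
          ≤ α * (L * ∑ i, volume (Metric.ball (x i) (r i)) +
              volume.restrict Wᶜ {x | α ≤ ∑ i, ‖Fb i x‖ₑ}) := by
            gcongr
            exact h3.trans (by gcongr)
        _ = L * (α * ∑ i, volume (Metric.ball (x i) (r i))) +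
              α * volume.restrict Wᶜ {x | α ≤ ∑ i, ‖Fb i x‖ₑ} := by ring
        _ ≤ L * (∫⁻ y, ‖f y‖ₑ) + C₁ * (2 * ∫⁻ y, ‖f y‖ₑ) :=
            add_le_add (mul_le_mul' le_rfl hvol) (h4.trans h2)
        _ = _ := by ring
    have hgood : α * volume {x | α < ‖Fg x‖ₑ} ≤ 2 * C₀ * D * ∫⁻ y, ‖f y‖ₑ := by
      refine (markov Fg α hα hFg.1).trans ?_
      -- Interpolation of the sup bound and the $L^1$ bound; $\alpha^{p-1}$ cancels the factor from
      -- Chebyshev's inequality.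
      have h1 : ∫⁻ y, ‖g y‖ₑ ^ p ≤ ((6 ^ n + 1) * α) ^ (p - 1) * ∫⁻ y, ‖g y‖ₑ := by
        rw [← lintegral_const_mul' _ _ (ENNReal.rpow_ne_top_of_nonneg hp1.le (by finiteness))]
        refine lintegral_mono fun y => ?_
        by_cases hy : ‖g y‖ₑ = 0
        · rw [hy, ENNReal.zero_rpow_of_pos hp0]; exact zero_le
        · have : ‖g y‖ₑ ^ p = ‖g y‖ₑ ^ (p - 1) * ‖g y‖ₑ := by
            conv_rhs => rw [← ENNReal.rpow_one ‖g y‖ₑ, ← ENNReal.rpow_mul, one_mul,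
              ← ENNReal.rpow_add _ _ hy enorm_ne_top, sub_add_cancel]
          rw [this]
          gcongr
          exact hgα y
      calc ((α : ℝ≥0∞) ^ (p - 1))⁻¹ * ∫⁻ x, ‖Fg x‖ₑ ^ p
          ≤ ((α : ℝ≥0∞) ^ (p - 1))⁻¹ * (C₀ * (((6 ^ n + 1) * α) ^ (p - 1) *
              (2 * ∫⁻ y, ‖f y‖ₑ))) := by
            gcongr
            exact (hC₀ g Fg hg hFg).trans (by gcongr; exact h1.trans (by gcongr))
        _ = (((α : ℝ≥0∞) ^ (p - 1))⁻¹ * (α : ℝ≥0∞) ^ (p - 1)) *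
              (2 * C₀ * D * ∫⁻ y, ‖f y‖ₑ) := by
            rw [ENNReal.mul_rpow_of_nonneg _ _ hp1.le]; ring
        _ = _ := by rw [ENNReal.inv_mul_cancel hαp0 hαpt, one_mul]
    have herr : α * volume {x | α < ‖Fe x‖ₑ} ≤ δ := by
      calc α * volume {x | α < ‖Fe x‖ₑ}
          ≤ ((α : ℝ≥0∞) ^ (p - 1))⁻¹ * ∫⁻ x, ‖Fe x‖ₑ ^ p := markov Fe α hα hFe.1
        _ ≤ ((α : ℝ≥0∞) ^ (p - 1))⁻¹ * (C₀ * (eLpNorm f ∞ volume ^ p * (δ / (κ + 1)))) := by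
            gcongr
            exact (hC₀ e Fe he hFe).trans (by gcongr)
        _ = κ * (δ / (κ + 1)) := by rw [hκ]; ring
        _ ≤ (κ + 1) * (δ / (κ + 1)) := by gcongr; exact le_self_add
        _ = δ := ENNReal.mul_div_cancel (by simp) (by finiteness)
    calc α * volume {x | (3 * α : ℝ≥0) < ‖F x‖ₑ}
        ≤ α * (volume {x | α < ∑ i, ‖Fb i x‖ₑ} +
            (volume {x | α < ‖Fg x‖ₑ} + volume {x | α < ‖Fe x‖ₑ})) := by gcongr
      _ = α * volume {x | α < ∑ i, ‖Fb i x‖ₑ} +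
            (α * volume {x | α < ‖Fg x‖ₑ} + α * volume {x | α < ‖Fe x‖ₑ}) := by ring
      _ ≤ (L + 2 * C₁) * (∫⁻ y, ‖f y‖ₑ) + (2 * C₀ * D * (∫⁻ y, ‖f y‖ₑ) + δ) :=
            add_le_add hbad (add_le_add hgood herr)
      _ = _ := by ring
  have hCt : 3 * (L + 2 * C₁ + 2 * C₀ * D) ≠ ∞ := by finiteness
  refine ⟨(3 * (L + 2 * C₁ + 2 * C₀ * D)).toNNReal, fun f F α hα hf hF => ?_⟩
  rw [ENNReal.coe_toNNReal hCt]
  have h3 : 3 * (α / 3) = α := mul_div_cancel₀ _ (by norm_num)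
  have := key f F (α / 3) (by positivity) hf hF
  rw [h3] at this
  calc α * volume {x | α < ‖F x‖ₑ}
      = 3 * (((α / 3 : ℝ≥0) : ℝ≥0∞) * volume {x | α < ‖F x‖ₑ}) := by
        rw [← mul_assoc]
        congr 1
        conv_lhs => rw [← h3]
        push_cast
        rfl
    _ ≤ 3 * ((L + 2 * C₁ + 2 * C₀ * D) * ∫⁻ y, ‖f y‖ₑ) := by gcongr
    _ = _ := by ring

end WeakType

/-! ### The oscillation bound for $\|Tf\|_X$. -/

section Oscillation

open BanachSequenceSpace

variable {n : ℕ} {X : Type*} [NormedAddCommGroup X] [NormedSpace ℝ X] [BanachSequenceSpace X]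
  {K : EuclideanSpace ℝ (Fin n) → X} {A : ℝ≥0 → ℝ≥0}

/-- The far part vanishes within distance $R$ of both points, so both values are absolutely
convergent integrals. The substitution $u=x_0-y$ turns their difference into a kernel difference
with shift $x_0-x$. -/
theorem enorm_singularIntegral_sub_le (hT : IsSingularIntegralOperator K) (hA : Continuous A)
    {f : EuclideanSpace ℝ (Fin n) → ℝ} (hf : MemLInftyC f) {x x₀ z : EuclideanSpace ℝ (Fin n)}
    {R : ℝ} (hR : 0 < R) (hx : ‖x₀ - x‖ < R) (hz : z ∈ Metric.ball x₀ (4 * R)) {l : ℤ}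
    (hd : daggerEntry (fun t => (A t : ℝ≥0∞)) K (x₀ - x) R l ≠ ∞)
    (hS : luxMaximal (complementary A) f z ≠ ∞) :
    ‖singularIntegral K ((Metric.closedBall x₀ (2 * R))ᶜ.indicator f) x l -
        singularIntegral K ((Metric.closedBall x₀ (2 * R))ᶜ.indicator f) x₀ l‖ₑ ≤
      2 * volume (Metric.ball (0 : EuclideanSpace ℝ (Fin n)) 2) *
        luxMaximal (complementary A) f z *
        daggerEntry (fun t => (A t : ℝ≥0∞)) K (x₀ - x) R l := by
  set f₂ := (Metric.closedBall x₀ (2 * R))ᶜ.indicator f with hf₂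
  have hf₂C : MemLInftyC f₂ := hf.indicator measurableSet_closedBall.compl
  have hzero : ∀ y, ‖x₀ - y‖ ≤ 2 * R → f₂ y = 0 := by
    intro y hy
    refine Set.indicator_of_notMem (Set.notMem_compl_iff.2 ?_) _
    rwa [Metric.mem_closedBall, dist_comm, dist_eq_norm]
  have hx₀ : ∀ y, ‖x₀ - y‖ < R → f₂ y = 0 := fun y hy => hzero y (by linarith)
  have hxx : ∀ y, ‖x - y‖ < R → f₂ y = 0 := by
    intro y hy
    refine hzero y ?_
    have := norm_sub_le_norm_sub_add_norm_sub x₀ x y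
    linarith
  rw [singularIntegral_eq_integral hR hxx, singularIntegral_eq_integral hR hx₀,
    ← integral_sub (integrable_kernelCoord_mul (hT.locallyIntegrable l) hf₂C hR hxx)
      (integrable_kernelCoord_mul (hT.locallyIntegrable l) hf₂C hR hx₀)]
  refine (enorm_integral_le_lintegral_enorm _).trans ?_
  refine le_trans ?_ (setLIntegral_kernelCoord_sub_mul_le hA
    (hT.aestronglyMeasurable_kernelCoord l) hR hz hd hS)
  rw [← lintegral_indicator (measurableSet_lt measurable_const measurable_norm),
    ← lintegral_sub_left_eq_self (fun y => ‖kernelCoord K l (x - y) * f₂ y -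
      kernelCoord K l (x₀ - y) * f₂ y‖ₑ) x₀]
  refine lintegral_mono fun u => ?_
  by_cases hu : 2 * R < ‖u‖
  · rw [Set.indicator_of_mem (show u ∈ {u | 2 * R < ‖u‖} from hu), ← sub_mul, enorm_mul,
      sub_sub_self, show x - (x₀ - u) = u - (x₀ - x) by abel, hf₂,
      enorm_indicator_eq_indicator_enorm]
    gcongr
    exact Set.indicator_le_self _ (fun y => ‖f y‖ₑ) _
  · rw [hzero (x₀ - u) (by rw [sub_sub_self]; exact not_lt.1 hu)]
    simp

/-- Each coordinate is bounded by a multiple of `t`, independent of `l`, times the dagger entry. The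
dagger sequence lies in $X$, so monotonicity puts the difference in $X$, even though neither value
is known to lie there. -/
theorem exists_coord_eq_singularIntegral_sub (hT : IsSingularIntegralOperator K)
    (hA : Continuous A) (hK : HormanderDagger (fun t => (A t : ℝ≥0∞)) K) :
    ∃ c : ℝ, 1 < c ∧ ∃ C : ℝ≥0, ∀ (f : EuclideanSpace ℝ (Fin n) → ℝ)
      (x x₀ z : EuclideanSpace ℝ (Fin n)) (r t : ℝ), MemLInftyC f → x ∈ Metric.ball x₀ r →
      z ∈ Metric.ball x₀ r → 0 < t → luxMaximal (complementary A) f z ≤ ENNReal.ofReal t →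
      ∃ v : X, coord v = singularIntegral K ((Metric.closedBall x₀ (2 * (c * r)))ᶜ.indicator f) x -
          singularIntegral K ((Metric.closedBall x₀ (2 * (c * r)))ᶜ.indicator f) x₀ ∧
        ‖v‖ ≤ C * t := by
  obtain ⟨c, hc, C, hC⟩ := hK
  set V : ℝ≥0∞ := 2 * volume (Metric.ball (0 : EuclideanSpace ℝ (Fin n)) 2) with hV
  have hVt : V ≠ ∞ := ENNReal.mul_ne_top (by simp) measure_ball_lt_top.ne
  refine ⟨c, hc, V.toNNReal * C, fun f x x₀ z r t hf hx hz ht hS => ?_⟩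
  have hr := Metric.pos_of_mem_ball hx
  have hx' : ‖x₀ - x‖ < r := by rwa [← dist_eq_norm, dist_comm]
  have hrR : r ≤ c * r := le_mul_of_one_le_left hr.le hc.le
  obtain ⟨hd, hdC⟩ := hC (x₀ - x) (c * r) (by gcongr)
  obtain ⟨u, hu, huC⟩ := exists_coord_eq_of_seqNorm_le hdC
  have hκ : (0 : ℝ) ≤ V.toReal * t := by positivity
  obtain ⟨v, hv, hvn⟩ := monotone_norm ((V.toReal * t) • u)
    (singularIntegral K ((Metric.closedBall x₀ (2 * (c * r)))ᶜ.indicator f) x -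
      singularIntegral K ((Metric.closedBall x₀ (2 * (c * r)))ᶜ.indicator f) x₀) (by
    intro l
    rw [map_smul, hu, Pi.smul_apply, smul_eq_mul, Pi.sub_apply,
      abs_of_nonneg (mul_nonneg hκ ENNReal.toReal_nonneg)]
    have h1 := enorm_singularIntegral_sub_le hT hA hf (by linarith : 0 < c * r)
      (hx'.trans_le hrR) (Metric.ball_subset_ball (by linarith) hz) (hd l)
      (ne_top_of_le_ne_top ENNReal.ofReal_ne_top hS)
    have h2 := h1.trans (mul_le_mul' (mul_le_mul' le_rfl hS) le_rfl)
    have h3 := ENNReal.toReal_mono (ENNReal.mul_ne_top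
      (ENNReal.mul_ne_top hVt ENNReal.ofReal_ne_top) (hd l)) h2
    rwa [toReal_enorm, ENNReal.toReal_mul, ENNReal.toReal_mul, ENNReal.toReal_ofReal ht.le,
      Real.norm_eq_abs] at h3)
  refine ⟨v, hv, hvn.trans ?_⟩
  rw [norm_smul, Real.norm_of_nonneg hκ]
  calc V.toReal * t * ‖u‖ ≤ V.toReal * t * C := by gcongr
    _ = _ := by push_cast; ring

variable [NeZero n] [CompleteSpace X]

/-- The norm of a vector-valued singular integral satisfies an oscillation bound in terms of the
maximal operator associated with the complementary function. -/
theorem exists_oscillationBound (hT : IsSingularIntegralOperator K)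
    (hA : Continuous A) (hK : HormanderDagger (fun t => (A t : ℝ≥0∞)) K) :
    ∃ Λ : ℝ≥0 → ℝ, (∀ ε, 0 < ε → 0 < Λ ε) ∧ ∀ (f : EuclideanSpace ℝ (Fin n) → ℝ)
      (F : EuclideanSpace ℝ (Fin n) → X), MemLInftyC f → RepresentsSingularIntegral K f F →
      ∀ ε, 0 < ε → OscillationBound volume (fun x => ‖F x‖) (luxMaximal (complementary A) f) ε
        (Λ ε) := by
  obtain ⟨c, hc, C, hC⟩ := exists_coord_eq_singularIntegral_sub hT hA hK
  obtain ⟨Cw, hCw⟩ := hT.exists_weakType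
  have hc0 : 0 < c := by linarith
  set M : ℝ≥0 := Cw * ((A 1 + 1) * ((4 * c) ^ n).toNNReal) with hM
  -- `C` bounds the far part. The weak type bounds the proportion where the near part exceeds $\beta
  -- t$ by $M/\beta$, which is at most `ε` for $\beta=(M+1)/\varepsilon$.
  refine ⟨fun ε => C + (M + 1) / ε, fun ε hε => by positivity, ?_⟩
  intro f F hf hF ε hε x₀ z r t ht hz hS
  have hr := Metric.pos_of_mem_ball hz
  have hrR : r ≤ c * r := le_mul_of_one_le_left hr.le hc.le
  set Q := Metric.closedBall x₀ (2 * (c * r)) with hQ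
  have hQm : MeasurableSet Q := measurableSet_closedBall
  have hf₁ : MemLInftyC (Q.indicator f) := hf.indicator hQm
  have hf₂ : MemLInftyC (Qᶜ.indicator f) := hf.indicator hQm.compl
  obtain ⟨F₁, hF₁⟩ := hT.exists_represents hf₁
  obtain ⟨F₂, hF₂⟩ := hT.exists_represents hf₂
  have hF12 : RepresentsSingularIntegral K f (F₁ + F₂) := by
    have := RepresentsSingularIntegral.add hT hf₁ hf₂ hF₁ hF₂
    rwa [Set.indicator_self_add_compl] at this
  have hBv : volume (Metric.ball x₀ r) ≠ 0 := (Metric.measure_ball_pos volume _ hr).ne'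
  -- The far part is known to be $X$-valued only almost everywhere. The centre is reached from a
  -- good point `y` of the ball by subtracting the $X$-valued difference.
  obtain ⟨a, ha⟩ : ∃ a : X, coord a = singularIntegral K (Qᶜ.indicator f) x₀ := by
    obtain ⟨y, hyB, hy⟩ := (frequently_ae_iff.2 hBv).and_eventually hF₂.2 |>.exists
    obtain ⟨v, hv, -⟩ := hC f y x₀ z r t hf hyB hz ht hS
    exact ⟨F₂ y - v, by rw [map_sub, hy, hv, sub_sub_cancel]⟩
  refine ⟨‖a‖, ?_⟩
  set β : ℝ := (M + 1) / ε with hβ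
  have hβ0 : 0 < β := by positivity
  set α : ℝ≥0 := (β * t).toNNReal with hα
  have hβt : 0 < β * t := by positivity
  have hα0 : 0 < α := Real.toNNReal_pos.2 hβt
  have hαc : (α : ℝ) = β * t := Real.coe_toNNReal _ hβt.le
  have hsub : volume {x ∈ Metric.ball x₀ r | (C + β) * t < |‖F x‖ - ‖a‖|} ≤
      volume {x | α < ‖F₁ x‖ₑ} := by
    refine measure_mono_ae ?_
    filter_upwards [hF.ae_eq hF12, hF₂.2] with x hx hx2 hxs
    obtain ⟨hxB, hlt⟩ := hxs
    obtain ⟨v, hv, hvC⟩ := hC f x x₀ z r t hf hxB hz ht hS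
    have hva : F₂ x = a + v := coord_injective (by rw [map_add, hx2, ha, hv]; abel)
    rw [Pi.add_apply, hva] at hx
    have h1 : |‖F x‖ - ‖a‖| ≤ ‖F₁ x‖ + ‖v‖ := by
      refine (abs_norm_sub_norm_le _ _).trans ?_
      rw [hx, show F₁ x + (a + v) - a = F₁ x + v by abel]
      exact norm_add_le _ _
    show (α : ℝ≥0∞) < ‖F₁ x‖ₑ
    rw [enorm_eq_nnnorm, ENNReal.coe_lt_coe, ← NNReal.coe_lt_coe, hαc, coe_nnnorm]
    linarith
  refine hsub.trans ?_
  have hI : ∫⁻ y, ‖Q.indicator f y‖ₑ ≤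
      ((A 1 + 1) * ((4 * c) ^ n).toNNReal : ℝ≥0) * volume (Metric.ball x₀ r) *
        ENNReal.ofReal t := by
    simp only [enorm_indicator_eq_indicator_enorm]
    rw [lintegral_indicator hQm]
    calc ∫⁻ y in Q, ‖f y‖ₑ ≤ ∫⁻ y in Metric.ball x₀ (4 * c * r), ‖f y‖ₑ :=
          lintegral_mono_set (Metric.closedBall_subset_ball (by nlinarith))
      _ ≤ (A 1 + 1) * volume (Metric.ball x₀ (4 * c * r)) *
            luxNorm (complementary A) f (Metric.ball x₀ (4 * c * r)) :=
          lintegral_enorm_le_luxNorm_complementary A (by positivity)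
      _ ≤ (A 1 + 1) * volume (Metric.ball x₀ (4 * c * r)) * ENNReal.ofReal t := by
          gcongr
          exact (luxNorm_le_luxMaximal _ _ (Metric.ball_subset_ball (by nlinarith) hz)).trans hS
      _ = _ := by
          rw [Measure.addHaar_ball_mul_of_pos volume _ (by positivity),
            ← Measure.addHaar_ball_center volume x₀, finrank_euclideanSpace_fin, ENNReal.ofReal]
          push_cast
          ring
  have hαt : (α : ℝ≥0∞) ≠ 0 := by simpa using hα0.ne'
  refine (ENNReal.mul_le_mul_iff_right hαt ENNReal.coe_ne_top).1 ?_
  calc α * volume {x | α < ‖F₁ x‖ₑ} ≤ Cw * ∫⁻ y, ‖Q.indicator f y‖ₑ :=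
        hCw _ F₁ α hα0 hf₁ hF₁
    _ ≤ Cw * (((A 1 + 1) * ((4 * c) ^ n).toNNReal : ℝ≥0) * volume (Metric.ball x₀ r) *
        ENNReal.ofReal t) := by gcongr
    _ = ((M * t.toNNReal : ℝ≥0) : ℝ≥0∞) * volume (Metric.ball x₀ r) := by
        rw [hM, ENNReal.ofReal]; push_cast; ring
    _ ≤ ((α * ε : ℝ≥0) : ℝ≥0∞) * volume (Metric.ball x₀ r) := by
        refine mul_le_mul' (ENNReal.coe_le_coe.2 ?_) le_rfl
        rw [← NNReal.coe_le_coe, NNReal.coe_mul M, NNReal.coe_mul α, hαc, Real.coe_toNNReal _ ht.le, hβ]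
        have hε' : (0 : ℝ) < ε := hε
        field_simp
        linarith
    _ = _ := by rw [ENNReal.coe_mul, mul_assoc]

end Oscillation

/-! ### The weighted inequality. -/

theorem singularIntegral_eq_zero_of_subsingleton {X : Type*} [NormedAddCommGroup X]
    [NormedSpace ℝ X] [BanachSequenceSpace X] (K : EuclideanSpace ℝ (Fin 0) → X)
    (f : EuclideanSpace ℝ (Fin 0) → ℝ) (x : EuclideanSpace ℝ (Fin 0)) :
    singularIntegral K f x = 0 := by
  funext l
  refine Tendsto.limUnder_eq (tendsto_const_nhds.congr' ?_)
  filter_upwards [self_mem_nhdsWithin] with ε (hε : 0 < ε)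
  have : {y : EuclideanSpace ℝ (Fin 0) | ε < ‖x - y‖} = ∅ := by
    ext y
    simp [Subsingleton.elim x y, hε.le]
  simp [truncInt, this]

theorem mainTheorem1 {n : ℕ} {X : Type*} [NormedAddCommGroup X] [NormedSpace ℝ X]
    [CompleteSpace X] [BanachSequenceSpace X]
    (A : ℝ≥0 → ℝ≥0) (hA : IsYoungFunction A)
    (K : EuclideanSpace ℝ (Fin n) → X) (hT : IsSingularIntegralOperator K)
    (hK : HormanderDagger (fun t => (A t : ℝ≥0∞)) K)
    (p : ℝ) (hp : 0 < p) (w : EuclideanSpace ℝ (Fin n) → ℝ) (hw : MuckenhouptAInfty w) :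
    ∃ C : ℝ≥0, ∀ f : EuclideanSpace ℝ (Fin n) → ℝ, MemLInftyC f →
      ∫⁻ x, seqNorm X (singularIntegral K f x) ^ p * ENNReal.ofReal (w x) < ∞ →
      ∫⁻ x, seqNorm X (singularIntegral K f x) ^ p * ENNReal.ofReal (w x) ≤
        C * ∫⁻ x, luxMaximal (complementary A) f x ^ p * ENNReal.ofReal (w x) := by
  -- Dimension $0$ is separate because null spheres and density arguments need a nontrivial space;
  -- there all truncation domains are empty.
  rcases Nat.eq_zero_or_pos n with rfl | hn
  · refine ⟨0, fun f _ _ => ?_⟩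
    have h0 : seqNorm X 0 = 0 := by
      rw [← map_zero (BanachSequenceSpace.coord : X →ₗ[ℝ] ℤ → ℝ), seqNorm_coord, enorm_zero]
    simp [singularIntegral_eq_zero_of_subsingleton, h0, hp]
  have : NeZero n := ⟨hn.ne'⟩
  obtain ⟨q, hq, hwq⟩ := hw
  have hwm : AEMeasurable (fun x => ENNReal.ofReal (w x)) :=
    hwq.2.1.aestronglyMeasurable.aemeasurable.ennreal_ofReal
  obtain ⟨Λ, hΛ, hosc⟩ := exists_oscillationBound hT hA.continuous hK
  obtain ⟨C, hC⟩ := exists_lintegral_rpow_le_of_oscillationBound (μ := volume)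
    (hwq.comparableOnBalls hq) (withDensity_absolutelyContinuous _ _) hp hΛ
  refine ⟨C, fun f hf hfin => ?_⟩
  obtain ⟨F₀, hF₀⟩ := hT.exists_represents hf
  -- A strongly measurable version makes the level sets of the norm measurable, as the
  -- good-$\lambda$ argument requires.
  set F := hF₀.1.mk F₀ with hFdef
  have hFm : StronglyMeasurable F := hF₀.1.stronglyMeasurable_mk
  have hF : RepresentsSingularIntegral K f F := by
    refine ⟨hFm.aestronglyMeasurable, ?_⟩
    filter_upwards [hF₀.1.ae_eq_mk, hF₀.2] with x hx hx2
    rw [← hx2, hx]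
  have hS := lowerSemicontinuous_luxMaximal (complementary A) f
  have hdens : ∀ ψ : EuclideanSpace ℝ (Fin n) → ℝ≥0∞, AEMeasurable ψ →
      ∫⁻ x, ψ x ∂weightMeasure w = ∫⁻ x, ψ x * ENNReal.ofReal (w x) := by
    intro ψ hψ
    rw [weightMeasure, lintegral_withDensity_eq_lintegral_mul₀ hwm hψ]
    simp only [Pi.mul_apply, mul_comm]
  have hleft : ∫⁻ x, seqNorm X (singularIntegral K f x) ^ p * ENNReal.ofReal (w x) =
      ∫⁻ x, ENNReal.ofReal ‖F x‖ ^ p ∂weightMeasure w := by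
    rw [hdens _ (hFm.norm.measurable.ennreal_ofReal.pow_const p).aemeasurable]
    refine lintegral_congr_ae ?_
    filter_upwards [hF.2] with x hx
    rw [← hx, seqNorm_coord, ofReal_norm]
  rw [hleft] at hfin ⊢
  rw [← hdens _ (hS.measurable.pow_const p).aemeasurable]
  exact hC _ _ hFm.norm.measurable (fun x => norm_nonneg _) hS (hosc f F hf hF) hfin
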